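/- Let $X$ be a complex manifold of dimension $n$ (Hausdorff and second countable; it need not be compact) with Kähler forms $\omega$ and $\chi$, and let $c\in\mathbb{R}$. For positive definite Hermitian $n\times n$ matrices $A,B$ put $Q_B(A)=\sum_{j=1}^n \lambda_j^{-1}$, where $\lambda_1,\dots,\lambda_n$ are the eigenvalues of $B^{-1}A$. For a Kähler form $\chi'$ on $X$ let $Q_\omega(\chi')$ be the function on $X$ given in local coordinates by $Q_B(A)$, where $B$ and $A$ are the coefficient matrices of $\omega$ and $\chi'$. The spaces $L^p(\omega)$ are taken with respect to the volume form $\omega^n/n!$. Let $\chi_k=\chi+\sqrt{-1}\,\partial\bar\partial\psi_k$ $(k\in\mathbb{N})$ be Kähler forms, where the $\psi_k$ are smooth real functions on $X$, and let $\psi_\infty$ be a measurable real function on $X$ such that $$\psi_k\to\psi_\infty \ \text{ in } L^1(\omega) \quad\text{(that is, } \|\psi_k-\psi_\infty\|_{L^1(\omega)}\to 0\text{)}\qquad\text{and}\qquad \|Q_\omega(\chi_k)-c\|_{L^2(\omega)}\to 0 .$$ Then $\chi_\infty=\chi+\sqrt{-1}\,\partial\bar\partial\psi_\infty$ is a closed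 positive $(1,1)$-current, and it is a viscosity subsolution, $Q_\omega(\chi_\infty)\le_v c$. The latter means the following. Let $x\in X$, take any holomorphic coordinate chart around $x$, and let $\varphi$ be any upper semicontinuous (i.e. plurisubharmonic) local potential of $\chi_\infty$ near $x$ in this chart, so that $\sqrt{-1}\,\partial\bar\partial\varphi=\chi_\infty$ as currents. If $q$ is a real $C^2$ function on a neighbourhood of $x$ with $q\ge\varphi$ there and $q(x)=\varphi(x)$, then the complex Hessian $H=\big(\partial^2 q/\partial z_j\partial\bar z_k(x)\big)$ is positive definite and $Q_{B}(H)\le c$, where $B$ is the coefficient matrix of $\omega$ at $x$ in the chart. -/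

import Mathlib

open scoped Manifold ContDiff Topology ComplexOrder
open MeasureTheory Filter

/-- The model space `ℂⁿ`. -/
abbrev Cn (n : ℕ) : Type := EuclideanSpace ℂ (Fin n)

namespace KahlerVisc

noncomputable section

/-! ### Hermitian matrices, the complex Hessian and the operator `Q` -/

/-- `Q_B(A) = ∑ 1 / λ_j`, where the `λ_j` are the eigenvalues of `B⁻¹ A`, listed with multiplicity
(the roots of the characteristic polynomial). For positive definite Hermitian `A` and `B` they are
positive real numbers. -/
def Q {n : ℕ} (B A : Matrix (Fin n) (Fin n) ℂ) : ℝ :=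
  (((B⁻¹ * A).charpoly.roots.map (fun l : ℂ => l⁻¹)).sum).re

/-- The `j`-th standard basis vector of `ℂⁿ`. -/
def stdVec {n : ℕ} (j : Fin n) : Cn n := EuclideanSpace.single j (1 : ℂ)

/-- The complex Hessian `∂² f / ∂z_j ∂z̄_k` of a real-valued function, that is, the coefficient
matrix of `√-1 ∂∂̄ f = √-1 ∑ (∂² f / ∂z_j ∂z̄_k) dz_j ∧ dz̄_k`. It is written with
`∂/∂z_j = (∂/∂x_j - √-1 ∂/∂y_j) / 2` and `∂/∂z̄_k = (∂/∂x_k + √-1 ∂/∂y_k) / 2`. -/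
def complexHessian {n : ℕ} (f : Cn n → ℝ) (z : Cn n) : Matrix (Fin n) (Fin n) ℂ :=
  let H : Cn n → Cn n → ℝ := fun v w => fderiv ℝ (fderiv ℝ f) z v w
  fun j k =>
    (((H (stdVec j) (stdVec k) + H (Complex.I • stdVec j) (Complex.I • stdVec k) : ℝ) : ℂ)
      + Complex.I *
        ((H (stdVec j) (Complex.I • stdVec k) - H (Complex.I • stdVec j) (stdVec k) : ℝ) : ℂ)) / 4

/-- The matrix `(g_{jk})` of a real `(1,1)`-form `a = √-1 ∑ g_{jk} dz_j ∧ dz̄_k` on the vector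
space `ℂⁿ`. Since `a(v, w) = √-1 ∑ g_{jk} (v_j w̄_k - w_j v̄_k)`, one has
`g_{jk} = (a(e_j, √-1 e_k) - √-1 a(e_j, e_k)) / 2`. -/
def hermMatrix {n : ℕ} (a : Cn n [⋀^Fin 2]→L[ℝ] ℝ) : Matrix (Fin n) (Fin n) ℂ :=
  fun j k =>
    ((a ![stdVec j, Complex.I • stdVec k] : ℂ) - Complex.I * (a ![stdVec j, stdVec k] : ℂ)) / 2

/-! ### Kähler forms on a complex manifold -/

/-- A holomorphic coordinate chart of the complex manifold `X`. -/
def IsHolChart (n : ℕ) {X : Type*} [TopologicalSpace X] [ChartedSpace (Cn n) X]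
    (e : OpenPartialHomeomorph X (Cn n)) : Prop :=
  e ∈ IsManifold.maximalAtlas 𝓘(ℂ, Cn n) ∞ X

/-- A (not necessarily continuous) real differential 2-form on the real manifold underlying `X`. -/
abbrev TwoForm (n : ℕ) (X : Type*) [TopologicalSpace X] [ChartedSpace (Cn n) X] : Type _ :=
  ∀ x : X, TangentSpace 𝓘(ℝ, Cn n) x [⋀^Fin 2]→L[ℝ] ℝ

/-- The expression of a 2-form in the chart `e`: its pullback under `e⁻¹`, a 2-form on
`e.target ⊆ ℂⁿ`. -/
def TwoForm.inChart {n : ℕ} {X : Type*} [TopologicalSpace X] [ChartedSpace (Cn n) X]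
    (a : TwoForm n X) (e : OpenPartialHomeomorph X (Cn n)) (z : Cn n) :
    Cn n [⋀^Fin 2]→L[ℝ] ℝ :=
  (a (e.symm z)).compContinuousLinearMap (mfderiv 𝓘(ℝ, Cn n) 𝓘(ℝ, Cn n) e.symm z)

/-- A Kähler form: a smooth closed positive real 2-form of type `(1,1)`. -/
structure KahlerForm (n : ℕ) (X : Type*) [TopologicalSpace X] [ChartedSpace (Cn n) X] where
  form : TwoForm n X
  smooth : ∀ e : OpenPartialHomeomorph X (Cn n), IsHolChart n e →
    ContDiffOn ℝ ∞ (form.inChart e) e.target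
  type_one_one : ∀ e : OpenPartialHomeomorph X (Cn n), IsHolChart n e → ∀ z ∈ e.target,
    ∀ v w : Cn n, form.inChart e z ![Complex.I • v, Complex.I • w] = form.inChart e z ![v, w]
  closed : ∀ e : OpenPartialHomeomorph X (Cn n), IsHolChart n e → ∀ z ∈ e.target,
    extDeriv (form.inChart e) z = 0
  positive : ∀ e : OpenPartialHomeomorph X (Cn n), IsHolChart n e → ∀ z ∈ e.target,
    ∀ v : Cn n, v ≠ 0 → 0 < form.inChart e z ![v, Complex.I • v]

section Manifold

variable {n : ℕ} {X : Type*} [TopologicalSpace X] [ChartedSpace (Cn n) X]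

/-- The Hermitian coefficient matrix of a Kähler form in the chart `e`. -/
def KahlerForm.coeff (a : KahlerForm n X) (e : OpenPartialHomeomorph X (Cn n)) (z : Cn n) :
    Matrix (Fin n) (Fin n) ℂ :=
  hermMatrix (a.form.inChart e z)

/-- The function `Q_ω(χ)` on `X`. The eigenvalues of `ω⁻¹ χ` do not depend on the chart, so the
preferred chart at `x` is used. -/
def Qform (om chi : KahlerForm n X) (x : X) : ℝ :=
  Q (om.coeff (chartAt (Cn n) x) (chartAt (Cn n) x x))
    (chi.coeff (chartAt (Cn n) x) (chartAt (Cn n) x x))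

/-- `χ' = χ + √-1 ∂∂̄ ψ` for a smooth real function `ψ`. -/
def IsAddDDbar (chi' chi : KahlerForm n X) (psi : X → ℝ) : Prop :=
  ContMDiff 𝓘(ℝ, Cn n) 𝓘(ℝ, ℝ) ∞ psi ∧
    ∀ e : OpenPartialHomeomorph X (Cn n), IsHolChart n e → ∀ z ∈ e.target,
      chi'.coeff e z = chi.coeff e z + complexHessian (fun w => psi (e.symm w)) z

/-- The volume measure `ωⁿ / n!` of a Kähler form `ω`. In a chart `e` it is the measure
`2ⁿ det(g) dλ` on `e.target`, where `g` is the coefficient matrix of `ω` and `λ` is Lebesgue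
measure. These measures agree on overlaps of charts, and the measure on `X` which restricts to all
of them is their supremum. -/
def KahlerForm.vol [MeasurableSpace X] (om : KahlerForm n X) : Measure X :=
  ⨆ (e : OpenPartialHomeomorph X (Cn n)) (_ : IsHolChart n e),
    (((volume : Measure (Cn n)).restrict e.target).withDensity
      (fun z => 2 ^ n * ENNReal.ofReal (om.coeff e z).det.re)).map e.symm

end Manifold

/-! ### Plurisubharmonic functions and viscosity subsolutions in `ℂⁿ` -/

/-- `φ` is plurisubharmonic on `V` and not identically `-∞` on any component of `V`: it is upper
semicontinuous with values in `[-∞, ∞)`, it is locally integrable, and it satisfies the sub-mean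
value inequality on each closed complex disc in `V`. -/
structure IsPSHOn {n : ℕ} (phi : Cn n → EReal) (V : Set (Cn n)) : Prop where
  usc : UpperSemicontinuousOn phi V
  ne_top : ∀ z ∈ V, phi z ≠ ⊤
  ae_ne_bot : ∀ᵐ z ∂((volume : Measure (Cn n)).restrict V), phi z ≠ ⊥
  locInt : LocallyIntegrableOn (fun z => (phi z).toReal) V volume
  submean : ∀ a ∈ V, ∀ b : Cn n, (∀ t : ℂ, ‖t‖ ≤ 1 → a + t • b ∈ V) → phi a ≠ ⊥ →
    (∀ᵐ θ : ℝ ∂((volume : Measure ℝ).restrict (Set.Ioc 0 (2 * Real.pi))),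
      phi (a + Complex.exp (θ * Complex.I) • b) ≠ ⊥) ∧
    IntervalIntegrable (fun θ : ℝ => (phi (a + Complex.exp (θ * Complex.I) • b)).toReal)
      volume 0 (2 * Real.pi) ∧
    (phi a).toReal ≤ (2 * Real.pi)⁻¹ *
      ∫ θ in (0 : ℝ)..(2 * Real.pi), (phi (a + Complex.exp (θ * Complex.I) • b)).toReal

/-- `q` is an upper test of `φ` at `z`: it is of class `C²` near `z`, it satisfies `q ≥ φ` near
`z`, and `q(z) = φ(z)`. -/
def IsUpperTest {n : ℕ} (q : Cn n → ℝ) (phi : Cn n → EReal) (z : Cn n) : Prop :=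
  ContDiffAt ℝ 2 q z ∧ (∀ᶠ y in 𝓝 z, phi y ≤ (q y : EReal)) ∧ phi z = (q z : EReal)

/-- `Q_A(√-1 ∂∂̄ φ)(z) ≤_v c`. As `Q_{A(z)}` is a function on positive definite matrices, the
inequality `Q_{A(z)}(√-1 ∂∂̄ q(z)) ≤ c` includes that `√-1 ∂∂̄ q(z)` is positive definite. -/
def ViscSubAt {n : ℕ} (A : Cn n → Matrix (Fin n) (Fin n) ℂ) (phi : Cn n → EReal) (c : ℝ)
    (z : Cn n) : Prop :=
  ∀ q : Cn n → ℝ, IsUpperTest q phi z →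
    (complexHessian q z).PosDef ∧ Q (A z) (complexHessian q z) ≤ c

/-- A test function on `V`: smooth, with compact support contained in `V`. -/
def IsTestOn {n : ℕ} (eta : Cn n → ℝ) (V : Set (Cn n)) : Prop :=
  ContDiff ℝ ∞ eta ∧ HasCompactSupport eta ∧ tsupport eta ⊆ V

/-- The coefficients `⟨∂² φ / ∂z_j ∂z̄_k, η⟩ = ∫ φ ∂² η / ∂z_j ∂z̄_k dλ` of the current
`√-1 ∂∂̄ φ`, for a locally integrable function `φ`. -/
def ddbarCurrent {n : ℕ} (phi : Cn n → ℝ) (eta : Cn n → ℝ) : Matrix (Fin n) (Fin n) ℂ :=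
  fun j k => ∫ z, (phi z : ℂ) * complexHessian eta z j k

/-! ### The current `χ + √-1 ∂∂̄ ψ` and viscosity subsolutions on `X` -/

section Current

variable {n : ℕ} {X : Type*} [TopologicalSpace X] [ChartedSpace (Cn n) X]

/-- The coefficients, in the chart `e`, of the current `χ + √-1 ∂∂̄ ψ`, where `ψ` is a locally
integrable function on `X`: the distributions
`η ↦ ∫ χ_{jk} η dλ + ∫ ψ ∂² η / ∂z_j ∂z̄_k dλ` on `e.target`. -/
def addCurrent (chi : KahlerForm n X) (psi : X → ℝ) (e : OpenPartialHomeomorph X (Cn n))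
    (eta : Cn n → ℝ) : Matrix (Fin n) (Fin n) ℂ :=
  fun j k => (∫ z, chi.coeff e z j k * (eta z : ℂ))
    + ddbarCurrent (fun w => psi (e.symm w)) eta j k

/-- The current `χ + √-1 ∂∂̄ ψ` is positive. -/
def IsPositiveCurrent (chi : KahlerForm n X) (psi : X → ℝ) : Prop :=
  ∀ e : OpenPartialHomeomorph X (Cn n), IsHolChart n e → ∀ eta : Cn n → ℝ,
    IsTestOn eta e.target → (∀ z, 0 ≤ eta z) → (addCurrent chi psi e eta).PosSemidef

/-- `φ` is an upper semicontinuous (that is, plurisubharmonic) local potential, on the open subset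
`V` of `e.target`, of the current `χ + √-1 ∂∂̄ ψ`: one has `√-1 ∂∂̄ φ = χ + √-1 ∂∂̄ ψ` as currents
on `V`. -/
def IsLocalPotential (chi : KahlerForm n X) (psi : X → ℝ) (e : OpenPartialHomeomorph X (Cn n))
    (V : Set (Cn n)) (phi : Cn n → EReal) : Prop :=
  IsOpen V ∧ V ⊆ e.target ∧ IsPSHOn phi V ∧ ∀ eta : Cn n → ℝ, IsTestOn eta V →
    ddbarCurrent (fun z => (phi z).toReal) eta = addCurrent chi psi e eta

/-- The current `χ + √-1 ∂∂̄ ψ` (which is closed, as `χ` is) is a viscosity subsolution: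
`Q_ω(χ + √-1 ∂∂̄ ψ) ≤_v c`. It is a positive current and, around each point and in each holomorphic
chart, each of its upper semicontinuous local potentials is a viscosity subsolution. -/
def IsViscositySubsolution (om chi : KahlerForm n X) (psi : X → ℝ) (c : ℝ) : Prop :=
  IsPositiveCurrent chi psi ∧
    ∀ (x : X) (e : OpenPartialHomeomorph X (Cn n)), IsHolChart n e → x ∈ e.source →
      ∀ (V : Set (Cn n)) (phi : Cn n → EReal), e x ∈ V → IsLocalPotential chi psi e V phi →
        ViscSubAt (om.coeff e) phi c (e x)

end Current

end

end KahlerVisc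

/-!
The sublevel sets of `Q_B(A) = tr (A⁻¹ B)` are convex and closed, and they are upward closed for the
order of Hermitian matrices. All three properties can be read off from the dual description
`Q_B(A) = sup_Z (2 Re tr(Z B) - Re tr(Zᴴ A Z B))` as a supremum of affine functions `dualQ B Z` of
`A` (`dualQ_le_Q`, `posDef_and_Q_le_of_dualQ_le`, `dualQ_anti`); in this form the inequality
`Q_B(A) ≤ c` makes sense for every matrix `A`, and it implies that a Hermitian `A` is positive
definite. In particular no eigenvalue of a limit of positive definite matrices has to be bounded
from below beforehand.

Work in a chart, near a point `z₀`, with `B = ω(z₀)`. Since the `ψ_k` converge in `L¹`, integration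
by parts shows that the forms `χ_k` converge weakly to the current `χ + √-1 ∂∂̄ ψ`
(`tendsto_smear_addCurrent`). Weak limits of positive forms are positive. Moreover, Jensen's
inequality (`IsTestOn.dualQ_smear_le`), the comparison of `Q_B` with `Q_{ω(z)}` for `z` near `z₀`
and the convergence of `Q_ω(χ_k)` to `c` show that the average of the limit current against any
probability density concentrated near `z₀` lies in the sublevel set `{Q_B ≤ (1 + δ) c}`
(`exists_forall_dualQ_addCurrent_le`).

Let `φ` be a plurisubharmonic potential of the limit current, touched from above at `z₀` by `q`. The
complex Hessian of the convolution `φ_ε` of `φ` with a radial kernel is such an average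
(`complexHessian_mollify`). By the sub-mean value property `φ_ε(z₀) ≥ φ(z₀) = q(z₀)`
(`IsPSHOn.le_mollify`), while `φ_ε` is at most slightly larger than `q`. Hence
`φ_ε - q - a ‖z - z₀‖²` has a local maximum close to `z₀`
(`IsPSHOn.exists_isLocalMax_mollify`). There the complex Hessian of `q + a ‖z - z₀‖²` is at least
that of `φ_ε`, so that it lies in the sublevel set, too. It remains to let the maximum point tend to
`z₀`, then `a → 0` and `δ → 0`.
-/

namespace KahlerVisc

/-! ### Dual description of the operator `Q` -/

section LinearAlgebra

open scoped Matrix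

variable {n : ℕ}

/-- The trace of the inverse of a positive definite matrix is the sum of the inverses of its
eigenvalues. -/
theorem sum_inv_roots_charpoly_eq_trace_inv {H : Matrix (Fin n) (Fin n) ℂ} (hH : H.PosDef) :
    (H.charpoly.roots.map (fun l : ℂ => l⁻¹)).sum = H⁻¹.trace := by
  have hne : ∀ i, (hH.1.eigenvalues i : ℂ) ≠ 0 := fun i => by
    exact_mod_cast (hH.eigenvalues_pos i).ne'
  set U : Matrix (Fin n) (Fin n) ℂ := hH.1.eigenvectorUnitary.1
  have hUU : U * star U = 1 := Unitary.coe_mul_star_self hH.1.eigenvectorUnitary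
  have hUU' : star U * U = 1 := Unitary.coe_star_mul_self hH.1.eigenvectorUnitary
  have hsp : H = U * Matrix.diagonal (fun i => (hH.1.eigenvalues i : ℂ)) * star U := by
    conv_lhs => rw [hH.1.spectral_theorem]
    rfl
  have hinv : H⁻¹ = U * Matrix.diagonal (fun i => (hH.1.eigenvalues i : ℂ)⁻¹) * star U := by
    apply Matrix.inv_eq_right_inv
    have : ∀ D E : Matrix (Fin n) (Fin n) ℂ, D * E = 1 →
        U * D * star U * (U * E * star U) = 1 := by
      intro D E hDE
      calc U * D * star U * (U * E * star U) = U * (D * (star U * U) * E) * star U := by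
            simp only [Matrix.mul_assoc]
        _ = 1 := by rw [hUU', Matrix.mul_one, hDE, Matrix.mul_one, hUU]
    refine (congrArg (· * _) hsp).trans (this _ _ ?_)
    rw [Matrix.diagonal_mul_diagonal]
    simp [hne]
  rw [hinv, Matrix.trace_mul_comm, ← Matrix.mul_assoc, hUU', Matrix.one_mul,
    Matrix.trace_diagonal, hH.1.roots_charpoly_eq_eigenvalues, Multiset.map_map]
  rfl

theorem exists_isUnit_conjTranspose_mul_self {B : Matrix (Fin n) (Fin n) ℂ} (hB : B.PosDef) :
    ∃ S : Matrix (Fin n) (Fin n) ℂ, IsUnit S ∧ B = Sᴴ * S := by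
  open scoped MatrixOrder in
  obtain ⟨S, hS⟩ := CStarAlgebra.nonneg_iff_eq_star_mul_self.mp hB.posSemidef.nonneg
  refine ⟨S, ?_, hS⟩
  have h := hB.isUnit
  rw [hS] at h
  rw [Matrix.isUnit_iff_isUnit_det] at h ⊢
  rw [Matrix.det_mul] at h
  exact isUnit_of_mul_isUnit_right h

theorem exists_conjTranspose_mul_self {B : Matrix (Fin n) (Fin n) ℂ} (hB : B.PosSemidef) :
    ∃ S : Matrix (Fin n) (Fin n) ℂ, B = Sᴴ * S := by
  open scoped MatrixOrder in
  obtain ⟨S, hS⟩ := CStarAlgebra.nonneg_iff_eq_star_mul_self.mp hB.nonneg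
  exact ⟨S, hS⟩

/-- `Q_B(A) = tr (A⁻¹ B)`: writing `B = Sᴴ S`, the matrix `B⁻¹ A` is similar to the positive
definite matrix `S⁻ᴴ A S⁻¹`. -/
theorem Q_eq_trace {A B : Matrix (Fin n) (Fin n) ℂ} (hA : A.PosDef) (hB : B.PosDef) :
    Q B A = (A⁻¹ * B).trace.re := by
  obtain ⟨S, hS, rfl⟩ := exists_isUnit_conjTranspose_mul_self hB
  have hSdet := (Matrix.isUnit_iff_isUnit_det S).mp hS
  have hSH : (Sᴴ).det ≠ 0 := by
    rw [Matrix.det_conjTranspose]; exact star_ne_zero.mpr hSdet.ne_zero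
  have hH : ((S⁻¹)ᴴ * A * S⁻¹).PosDef := by
    refine hA.conjTranspose_mul_mul_same ?_
    apply Matrix.mulVec_injective_of_isUnit
    rwa [Matrix.isUnit_nonsing_inv_iff]
  have hconj : (Sᴴ * S)⁻¹ * A = S⁻¹ * (((S⁻¹)ᴴ * A * S⁻¹) * S) := by
    rw [Matrix.mul_inv_rev, Matrix.conjTranspose_nonsing_inv]
    simp only [Matrix.mul_assoc]
    rw [Matrix.nonsing_inv_mul _ hSdet, Matrix.mul_one]
  have hchar : ((Sᴴ * S)⁻¹ * A).charpoly = ((S⁻¹)ᴴ * A * S⁻¹).charpoly := by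
    rw [hconj, Matrix.charpoly_mul_comm, Matrix.mul_assoc, Matrix.mul_nonsing_inv _ hSdet,
      Matrix.mul_one]
  unfold Q
  rw [hchar, sum_inv_roots_charpoly_eq_trace_inv hH]
  congr 1
  rw [Matrix.mul_inv_rev, Matrix.mul_inv_rev, Matrix.nonsing_inv_nonsing_inv _ hSdet,
    Matrix.conjTranspose_nonsing_inv, Matrix.nonsing_inv_nonsing_inv _ (isUnit_iff_ne_zero.mpr hSH),
    Matrix.trace_mul_comm, Matrix.mul_assoc]

theorem trace_conjTranspose_mul_mul_mul_nonneg {D B : Matrix (Fin n) (Fin n) ℂ}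
    (hD : D.PosSemidef) (hB : B.PosSemidef) (Z : Matrix (Fin n) (Fin n) ℂ) :
    0 ≤ (Zᴴ * D * Z * B).trace.re := by
  obtain ⟨S, rfl⟩ := exists_conjTranspose_mul_self hB
  have h := ((hD.conjTranspose_mul_mul_same Z).mul_mul_conjTranspose_same S).trace_nonneg
  rw [Matrix.trace_mul_comm, ← Matrix.mul_assoc, Matrix.trace_mul_comm] at h
  exact (Complex.le_def.mp h).1

/-- The affine function `A ↦ 2 Re tr(Z B) - Re tr(Zᴴ A Z B)`. On positive definite matrices `A`,
the supremum of these functions over all `Z` is `tr (A⁻¹ B)`, attained at `Z = A⁻¹`. -/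
noncomputable def dualQ (B Z A : Matrix (Fin n) (Fin n) ℂ) : ℝ :=
  2 * (Z * B).trace.re - (Zᴴ * A * Z * B).trace.re

/-- The Fenchel inequality for `Q_B`, obtained by expanding
`tr ((Z - A⁻¹)ᴴ A (Z - A⁻¹) B) ≥ 0`. -/
theorem dualQ_le_Q {A B : Matrix (Fin n) (Fin n) ℂ} (hA : A.PosDef) (hB : B.PosDef)
    (Z : Matrix (Fin n) (Fin n) ℂ) : dualQ B Z A ≤ Q B A := by
  rw [Q_eq_trace hA hB]
  have h := trace_conjTranspose_mul_mul_mul_nonneg hA.posSemidef hB.posSemidef (Z - A⁻¹)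
  have hdet := (Matrix.isUnit_iff_isUnit_det A).mp hA.isUnit
  have hAi : (A⁻¹)ᴴ = A⁻¹ := hA.inv.1
  have hexp : (Z - A⁻¹)ᴴ * A * (Z - A⁻¹) * B
      = Zᴴ * A * Z * B - Zᴴ * B - Z * B + A⁻¹ * B := by
    rw [Matrix.conjTranspose_sub, hAi]
    simp only [Matrix.sub_mul, Matrix.mul_sub, Matrix.nonsing_inv_mul _ hdet, Matrix.one_mul]
    rw [Matrix.mul_assoc Zᴴ A A⁻¹, Matrix.mul_nonsing_inv _ hdet, Matrix.mul_one]
    abel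
  have hstar : (Zᴴ * B).trace.re = (Z * B).trace.re := by
    rw [← hB.1, ← Matrix.conjTranspose_mul, Matrix.trace_conjTranspose, hB.1, Matrix.trace_mul_comm]
    simp
  rw [hexp] at h
  simp only [Matrix.trace_add, Matrix.trace_sub, Complex.add_re, Complex.sub_re, hstar] at h
  unfold dualQ
  linarith

theorem dualQ_anti {A A' B : Matrix (Fin n) (Fin n) ℂ} (hA : (A' - A).PosSemidef)
    (hB : B.PosSemidef) (Z : Matrix (Fin n) (Fin n) ℂ) : dualQ B Z A' ≤ dualQ B Z A := by
  have h := trace_conjTranspose_mul_mul_mul_nonneg hA hB Z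
  rw [Matrix.mul_sub, Matrix.sub_mul, Matrix.sub_mul, Matrix.trace_sub, Complex.sub_re] at h
  unfold dualQ
  linarith

theorem Q_le_mul_Q {A B B' : Matrix (Fin n) (Fin n) ℂ} (hA : A.PosDef) (hB : B.PosDef)
    (hB' : B'.PosDef) {s : ℝ} (h : ((s : ℂ) • B' - B).PosSemidef) : Q B A ≤ s * Q B' A := by
  rw [Q_eq_trace hA hB, Q_eq_trace hA hB']
  have h1 := trace_conjTranspose_mul_mul_mul_nonneg hA.posSemidef h A⁻¹
  have hdet := (Matrix.isUnit_iff_isUnit_det A).mp hA.isUnit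
  rw [hA.inv.1, Matrix.nonsing_inv_mul _ hdet, Matrix.one_mul, Matrix.mul_sub, Matrix.trace_sub,
    Matrix.mul_smul, Matrix.trace_smul, Complex.sub_re, smul_eq_mul, Complex.re_ofReal_mul] at h1
  linarith

/-- The dual description of the sublevel sets of `Q_B`: a Hermitian matrix at which all the affine
functions `dualQ B Z` are at most `c` is positive definite. Testing with `Z = t v vᴴ` for large `t`
excludes a vector `v` with `vᴴ A v ≤ 0`. -/
theorem posDef_and_Q_le_of_dualQ_le {A B : Matrix (Fin n) (Fin n) ℂ} (hA : A.IsHermitian)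
    (hB : B.PosDef) {c : ℝ} (h : ∀ Z, dualQ B Z A ≤ c) : A.PosDef ∧ Q B A ≤ c := by
  have hpos : A.PosDef := by
    refine Matrix.PosDef.of_dotProduct_mulVec_pos hA fun v hv => ?_
    have him : (star v ⬝ᵥ (A *ᵥ v)).im = 0 := hA.im_star_dotProduct_mulVec_self v
    rw [Complex.lt_def]
    refine ⟨?_, him.symm⟩
    by_contra! hle
    have hBv := hB.dotProduct_mulVec_pos hv
    set b := star v ⬝ᵥ (B *ᵥ v)
    set a := star v ⬝ᵥ (A *ᵥ v)
    have hb : 0 < b.re := (Complex.lt_def.mp hBv).1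
    have hbi : b.im = 0 := (Complex.lt_def.mp hBv).2.symm
    have key : ∀ t : ℝ, dualQ B ((t : ℂ) • Matrix.vecMulVec v (star v)) A
        = 2 * (t * b.re) - t ^ 2 * (a.re * b.re) := by
      intro t
      have e1 : (((t : ℂ) • Matrix.vecMulVec v (star v)) * B).trace = t * b := by
        rw [Matrix.smul_mul, Matrix.trace_smul, Matrix.vecMulVec_mul, Matrix.trace_vecMulVec,
          smul_eq_mul, dotProduct_comm, ← Matrix.dotProduct_mulVec]
      have e2 : (((t : ℂ) • Matrix.vecMulVec v (star v))ᴴ * A *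
          ((t : ℂ) • Matrix.vecMulVec v (star v)) * B).trace = (t : ℂ) ^ 2 * (a * b) := by
        rw [Matrix.conjTranspose_smul, Matrix.conjTranspose_vecMulVec, star_star]
        simp only [Matrix.smul_mul, Matrix.mul_smul, Matrix.trace_smul, Matrix.vecMulVec_mul,
          smul_eq_mul]
        rw [Matrix.vecMul_vecMulVec, Matrix.smul_vecMul, Matrix.trace_vecMulVec, dotProduct_smul,
          dotProduct_comm v (star v ᵥ* B), ← Matrix.dotProduct_mulVec, ← Matrix.dotProduct_mulVec,
          smul_eq_mul, Complex.star_def, Complex.conj_ofReal]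
        ring
      unfold dualQ
      rw [e1, e2]
      have e3 : ((t : ℂ) ^ 2 * (a * b)).re = t ^ 2 * (a.re * b.re) := by
        rw [← Complex.ofReal_pow, Complex.re_ofReal_mul, Complex.mul_re, hbi]; ring
      rw [e3, Complex.re_ofReal_mul]
    -- For this `t` the linear term `2 t b` equals `2 (|c| + 1) > c`.
    have h1 := (key ((|c| + 1) / b.re)).symm.trans_le (h _)
    have h2 : 2 * ((|c| + 1) / b.re * b.re) = 2 * (|c| + 1) := by field_simp
    have h3 : ((|c| + 1) / b.re) ^ 2 * (a.re * b.re) ≤ 0 := by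
      refine mul_nonpos_of_nonneg_of_nonpos (by positivity) ?_
      exact mul_nonpos_of_nonpos_of_nonneg (by simpa using hle) hb.le
    have h4 := le_abs_self c
    have h5 := abs_nonneg c
    linarith
  refine ⟨hpos, ?_⟩
  have h1 := h A⁻¹
  have hdet := (Matrix.isUnit_iff_isUnit_det A).mp hpos.isUnit
  rw [dualQ, hpos.inv.1, Matrix.nonsing_inv_mul _ hdet, Matrix.one_mul] at h1
  rw [Q_eq_trace hpos hB]
  linarith

end LinearAlgebra

/-! ### Forms of type `(1,1)` and their Hermitian matrices -/

section Sesquilinear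

open scoped Matrix

variable {n : ℕ}

/-- A real bilinear map on `ℂⁿ` which is complex linear in the first and conjugate linear in the
second argument is determined by its matrix. -/
theorem sesquilinear_eq_sum (b : Cn n →ₗ[ℝ] Cn n →ₗ[ℝ] ℂ)
    (h1 : ∀ v w, b (Complex.I • v) w = Complex.I * b v w)
    (h2 : ∀ v w, b v (Complex.I • w) = -Complex.I * b v w) (v w : Cn n) :
    b v w = ∑ j, ∑ k, v j * star (w k) * b (stdVec j) (stdVec k) := by
  have smul_eq : ∀ (c : ℂ) (v : Cn n), c • v = c.re • v + c.im • (Complex.I • v) := by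
    intro c v
    ext i
    simp only [PiLp.smul_apply, PiLp.add_apply, Complex.real_smul, smul_eq_mul]
    conv_lhs => rw [← Complex.re_add_im c]
    ring
  have h1' : ∀ (c : ℂ) v w, b (c • v) w = c * b v w := by
    intro c v w
    rw [smul_eq c v, map_add, map_smul, map_smul, LinearMap.add_apply, LinearMap.smul_apply,
      LinearMap.smul_apply, h1, Complex.real_smul, Complex.real_smul]
    conv_rhs => rw [← Complex.re_add_im c]
    ring
  have h2' : ∀ (c : ℂ) v w, b v (c • w) = star c * b v w := by
    intro c v w
    rw [smul_eq c w, map_add, map_smul, map_smul, h2, Complex.real_smul, Complex.real_smul]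
    have : star c = c.re - c.im * Complex.I := by
      apply Complex.ext <;> simp
    rw [this]
    ring
  have hv : ∀ v : Cn n, v = ∑ j, v j • stdVec j := by
    intro v
    ext i
    simp [stdVec, Pi.single_apply]
  conv_lhs => rw [hv v, hv w]
  rw [map_sum b, LinearMap.sum_apply]
  refine Finset.sum_congr rfl fun j _ => ?_
  rw [map_sum]
  refine Finset.sum_congr rfl fun k _ => ?_
  rw [h1', h2']
  ring

theorem star_dotProduct_mulVec_eq_sum (A : Matrix (Fin n) (Fin n) ℂ) (x : Fin n → ℂ) :
    star x ⬝ᵥ (A *ᵥ x) = ∑ j, ∑ k, star (x j) * star (star (x k)) * A j k := by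
  simp only [dotProduct, Matrix.mulVec, Pi.star_apply, Finset.mul_sum, star_star]
  refine Finset.sum_congr rfl fun j _ => Finset.sum_congr rfl fun k _ => by ring

theorem update_pair_zero {E : Type*} (v w u : E) : Function.update ![v, w] 0 u = ![u, w] := by
  ext i; fin_cases i <;> simp

theorem update_pair_one {E : Type*} (v w u : E) : Function.update ![v, w] 1 u = ![v, u] := by
  ext i; fin_cases i <;> simp

theorem alternating_add_left (a : Cn n [⋀^Fin 2]→L[ℝ] ℝ) (v v' w : Cn n) :
    a ![v + v', w] = a ![v, w] + a ![v', w] := by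
  simpa only [update_pair_zero] using a.map_update_add ![v, w] 0 v v'

theorem alternating_add_right (a : Cn n [⋀^Fin 2]→L[ℝ] ℝ) (v w w' : Cn n) :
    a ![v, w + w'] = a ![v, w] + a ![v, w'] := by
  simpa only [update_pair_one] using a.map_update_add ![v, w] 1 w w'

theorem alternating_smul_left (a : Cn n [⋀^Fin 2]→L[ℝ] ℝ) (c : ℝ) (v w : Cn n) :
    a ![c • v, w] = c * a ![v, w] := by
  simpa only [update_pair_zero, smul_eq_mul] using a.map_update_smul ![v, w] 0 c v

theorem alternating_smul_right (a : Cn n [⋀^Fin 2]→L[ℝ] ℝ) (c : ℝ) (v w : Cn n) :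
    a ![v, c • w] = c * a ![v, w] := by
  simpa only [update_pair_one, smul_eq_mul] using a.map_update_smul ![v, w] 1 c w

/-- The Hermitian form `(a(v, √-1 w) - √-1 a(v, w)) / 2` of a real 2-form `a`. -/
noncomputable def formSesq (a : Cn n [⋀^Fin 2]→L[ℝ] ℝ) : Cn n →ₗ[ℝ] Cn n →ₗ[ℝ] ℂ :=
  LinearMap.mk₂ ℝ
    (fun v w => ((a ![v, Complex.I • w] : ℂ) - Complex.I * (a ![v, w] : ℂ)) / 2)
    (fun v v' w => by
      simp only [alternating_add_left]
      push_cast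
      ring)
    (fun c v w => by
      simp only [alternating_smul_left, Complex.real_smul]
      push_cast
      ring)
    (fun v w w' => by
      simp only [smul_add, alternating_add_right]
      push_cast
      ring)
    (fun c v w => by
      rw [smul_comm Complex.I c w]
      simp only [alternating_smul_right, Complex.real_smul]
      push_cast
      ring)

theorem formSesq_apply (a : Cn n [⋀^Fin 2]→L[ℝ] ℝ) (v w : Cn n) :
    formSesq a v w = ((a ![v, Complex.I • w] : ℂ) - Complex.I * (a ![v, w] : ℂ)) / 2 := rfl

theorem alternating_neg_right (a : Cn n [⋀^Fin 2]→L[ℝ] ℝ) (v w : Cn n) :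
    a ![v, -w] = -a ![v, w] := by
  simpa using alternating_smul_right a (-1 : ℝ) v w

theorem alternating_swap (a : Cn n [⋀^Fin 2]→L[ℝ] ℝ) (v w : Cn n) :
    a ![v, w] = -a ![w, v] := by
  have h := a.toAlternatingMap.map_swap ![w, v] (i := 0) (j := 1) (by decide)
  have e : (![w, v] : Fin 2 → Cn n) ∘ Equiv.swap 0 1 = ![v, w] := by
    ext i; fin_cases i <;> simp
  rw [e] at h
  exact h

theorem I_smul_I_smul (v : Cn n) : Complex.I • (Complex.I • v) = -v := by
  rw [smul_smul, Complex.I_mul_I, neg_one_smul]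

variable {a : Cn n [⋀^Fin 2]→L[ℝ] ℝ}

theorem alternating_I_left
    (ha : ∀ v w : Cn n, a ![Complex.I • v, Complex.I • w] = a ![v, w]) (v w : Cn n) :
    a ![Complex.I • v, w] = -a ![v, Complex.I • w] := by
  rw [← ha v (Complex.I • w), I_smul_I_smul, alternating_neg_right, neg_neg]

theorem formSesq_eq_sum
    (ha : ∀ v w : Cn n, a ![Complex.I • v, Complex.I • w] = a ![v, w]) (v w : Cn n) :
    formSesq a v w = ∑ j, ∑ k, v j * star (w k) * hermMatrix a j k := by
  refine sesquilinear_eq_sum (formSesq a) ?_ ?_ v w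
  · intro v w
    rw [formSesq_apply, formSesq_apply, ha, alternating_I_left ha]
    push_cast
    linear_combination ((a ![v, w] : ℂ) / 2) * Complex.I_mul_I
  · intro v w
    rw [formSesq_apply, formSesq_apply, I_smul_I_smul, alternating_neg_right]
    push_cast
    linear_combination (-(a ![v, w] : ℂ) / 2) * Complex.I_mul_I

theorem hermMatrix_posDef
    (ha : ∀ v w : Cn n, a ![Complex.I • v, Complex.I • w] = a ![v, w])
    (hpos : ∀ v : Cn n, v ≠ 0 → 0 < a ![v, Complex.I • v]) : (hermMatrix a).PosDef := by
  refine Matrix.PosDef.of_dotProduct_mulVec_pos ?_ fun x hx => ?_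
  · ext j k
    rw [Matrix.conjTranspose_apply]
    simp only [hermMatrix]
    rw [alternating_swap a (stdVec k) (Complex.I • stdVec j), alternating_I_left ha, neg_neg,
      alternating_swap a (stdVec k) (stdVec j)]
    simp only [Complex.star_def, map_div₀, map_sub, map_mul, Complex.conj_ofReal, Complex.conj_I,
      map_ofNat]
    push_cast
    ring
  · set v : Cn n := WithLp.toLp 2 (star x) with hv
    have hv0 : v ≠ 0 := by
      intro h
      apply hx
      have : star x = 0 := by
        simpa [hv] using congrArg WithLp.ofLp h
      simpa using this
    have e : star x ⬝ᵥ (hermMatrix a *ᵥ x) = ((a ![v, Complex.I • v] / 2 : ℝ) : ℂ) := by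
      have h0 : a ![v, v] = 0 := by
        have := alternating_swap a v v
        linarith
      rw [star_dotProduct_mulVec_eq_sum]
      refine (formSesq_eq_sum ha v v).symm.trans ?_
      rw [formSesq_apply, h0]
      push_cast
      ring
    rw [e]
    exact Complex.zero_lt_real.mpr (half_pos (hpos v hv0))

/-- Under a complex linear change of coordinates `J`, the matrix of a form of type `(1,1)` changes
to `Mᴴ g M`, where `M` is the conjugate of the matrix of `J`. -/
theorem hermMatrix_compContinuousLinearMap
    (ha : ∀ v w : Cn n, a ![Complex.I • v, Complex.I • w] = a ![v, w])
    (J : Cn n →L[ℝ] Cn n) (hJ : ∀ v, J (Complex.I • v) = Complex.I • J v) :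
    hermMatrix (a.compContinuousLinearMap J)
      = (Matrix.of fun l j => star (J (stdVec j) l))ᴴ * hermMatrix a
        * Matrix.of fun l j => star (J (stdVec j) l) := by
  have hcomp : ∀ v w, a.compContinuousLinearMap J ![v, w] = a ![J v, J w] := by
    intro v w
    rw [ContinuousAlternatingMap.compContinuousLinearMap_apply]
    congr 1
    ext i; fin_cases i <;> simp
  ext j k
  have h := formSesq_eq_sum ha (J (stdVec j)) (J (stdVec k))
  rw [formSesq_apply] at h
  have e : hermMatrix (a.compContinuousLinearMap J) j k
      = ((a ![J (stdVec j), Complex.I • J (stdVec k)] : ℂ)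
        - Complex.I * (a ![J (stdVec j), J (stdVec k)] : ℂ)) / 2 := by
    simp only [hermMatrix, hcomp, hJ]
  rw [e, h, Matrix.mul_apply]
  simp only [Matrix.mul_apply, Matrix.conjTranspose_apply, Matrix.of_apply, star_star,
    Finset.sum_mul]
  rw [Finset.sum_comm]
  refine Finset.sum_congr rfl fun j _ => Finset.sum_congr rfl fun k _ => by ring

theorem Q_conjTranspose_mul_mul {A B M : Matrix (Fin n) (Fin n) ℂ} (hA : A.PosDef) (hB : B.PosDef)
    (hA' : (Mᴴ * A * M).PosDef) (hB' : (Mᴴ * B * M).PosDef) :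
    Q (Mᴴ * B * M) (Mᴴ * A * M) = Q B A := by
  have hdet := ((Matrix.isUnit_iff_isUnit_det _).mp hA'.isUnit)
  rw [Matrix.det_mul, Matrix.det_mul] at hdet
  have hM : IsUnit M.det := isUnit_of_mul_isUnit_right hdet
  have hMH : IsUnit (Mᴴ).det := isUnit_of_mul_isUnit_left (isUnit_of_mul_isUnit_left hdet)
  rw [Q_eq_trace hA' hB', Q_eq_trace hA hB]
  congr 1
  have e : (Mᴴ * A * M)⁻¹ * (Mᴴ * B * M) = M⁻¹ * (A⁻¹ * B * M) := by
    rw [Matrix.mul_inv_rev, Matrix.mul_inv_rev]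
    calc M⁻¹ * (A⁻¹ * (Mᴴ)⁻¹) * (Mᴴ * B * M) = M⁻¹ * (A⁻¹ * ((Mᴴ)⁻¹ * Mᴴ) * B * M) := by
          simp only [Matrix.mul_assoc]
      _ = _ := by rw [Matrix.nonsing_inv_mul _ hMH, Matrix.mul_one]
  rw [e, Matrix.trace_mul_comm, Matrix.mul_assoc, Matrix.mul_nonsing_inv _ hM, Matrix.mul_one]

end Sesquilinear

/-! ### Algebra and the maximum principle for the complex Hessian -/

section ComplexHessian

open scoped Matrix

variable {n : ℕ}

/-- The complex Hessian form attached to a real bilinear form `D`. -/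
noncomputable def hessSesq (D : Cn n →L[ℝ] Cn n →L[ℝ] ℝ) : Cn n →ₗ[ℝ] Cn n →ₗ[ℝ] ℂ :=
  LinearMap.mk₂ ℝ
    (fun v w => (((D v w + D (Complex.I • v) (Complex.I • w) : ℝ) : ℂ)
      + Complex.I * ((D v (Complex.I • w) - D (Complex.I • v) w : ℝ) : ℂ)) / 4)
    (by
      intro v v' w
      simp only [smul_add, map_add, add_apply]
      push_cast
      ring)
    (by
      intro c v w
      simp only [smul_comm Complex.I c, map_smul, smul_apply, smul_eq_mul,
        Complex.real_smul]
      push_cast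
      ring)
    (by
      intro v w w'
      simp only [smul_add, map_add]
      push_cast
      ring)
    (by
      intro c v w
      simp only [smul_comm Complex.I c, map_smul, smul_eq_mul, Complex.real_smul]
      push_cast
      ring)

theorem hessSesq_apply (D : Cn n →L[ℝ] Cn n →L[ℝ] ℝ) (v w : Cn n) :
    hessSesq D v w = (((D v w + D (Complex.I • v) (Complex.I • w) : ℝ) : ℂ)
      + Complex.I * ((D v (Complex.I • w) - D (Complex.I • v) w : ℝ) : ℂ)) / 4 := rfl

theorem complexHessian_apply (f : Cn n → ℝ) (z : Cn n) (j k : Fin n) :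
    complexHessian f z j k = hessSesq (fderiv ℝ (fderiv ℝ f) z) (stdVec j) (stdVec k) := rfl

theorem hessSesq_eq_sum (D : Cn n →L[ℝ] Cn n →L[ℝ] ℝ) (v w : Cn n) :
    hessSesq D v w = ∑ j, ∑ k, v j * star (w k) * hessSesq D (stdVec j) (stdVec k) := by
  refine sesquilinear_eq_sum (hessSesq D) ?_ ?_ v w
  · intro v w
    simp only [hessSesq_apply, I_smul_I_smul, map_neg, neg_apply]
    push_cast
    linear_combination (-(D v (Complex.I • w) - D (Complex.I • v) w : ℂ) / 4) * Complex.I_mul_I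
  · intro v w
    simp only [hessSesq_apply, I_smul_I_smul, map_neg]
    push_cast
    linear_combination ((D v (Complex.I • w) - D (Complex.I • v) w : ℂ) / 4) * Complex.I_mul_I

theorem complexHessian_isHermitian {f : Cn n → ℝ} {z : Cn n} (hf : ContDiffAt ℝ 2 f z) :
    (complexHessian f z).IsHermitian := by
  have hs : ∀ v w, fderiv ℝ (fderiv ℝ f) z v w = fderiv ℝ (fderiv ℝ f) z w v :=
    hf.isSymmSndFDerivAt (by simp)
  ext j k
  rw [Matrix.conjTranspose_apply, complexHessian_apply, complexHessian_apply, hessSesq_apply,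
    hessSesq_apply, hs (stdVec k), hs (Complex.I • stdVec k) (Complex.I • stdVec j),
    hs (stdVec k) (Complex.I • stdVec j), hs (Complex.I • stdVec k) (stdVec j)]
  simp only [Complex.star_def, map_div₀, map_add, map_mul, Complex.conj_ofReal, Complex.conj_I,
      map_ofNat]
  push_cast
  ring

theorem star_dotProduct_complexHessian_mulVec {f : Cn n → ℝ} {z : Cn n}
    (hf : ContDiffAt ℝ 2 f z) (x : Fin n → ℂ) :
    star x ⬝ᵥ (complexHessian f z *ᵥ x)
      = (((fderiv ℝ (fderiv ℝ f) z (WithLp.toLp 2 (star x)) (WithLp.toLp 2 (star x))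
        + fderiv ℝ (fderiv ℝ f) z (Complex.I • WithLp.toLp 2 (star x))
          (Complex.I • WithLp.toLp 2 (star x))) / 4 : ℝ) : ℂ) := by
  have hs : ∀ v w, fderiv ℝ (fderiv ℝ f) z v w = fderiv ℝ (fderiv ℝ f) z w v :=
    hf.isSymmSndFDerivAt (by simp)
  rw [star_dotProduct_mulVec_eq_sum]
  refine (hessSesq_eq_sum _ (WithLp.toLp 2 (star x)) (WithLp.toLp 2 (star x))).symm.trans ?_
  rw [hessSesq_apply, hs (WithLp.toLp 2 (star x)) (Complex.I • WithLp.toLp 2 (star x)),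
    sub_self]
  push_cast
  ring

theorem contDiffAt_fderiv {f : Cn n → ℝ} {z : Cn n} (hf : ContDiffAt ℝ 2 f z) :
    ContDiffAt ℝ 1 (fderiv ℝ f) z :=
  hf.fderiv_right (m := 1) (by norm_num)

theorem eventually_differentiableAt {f : Cn n → ℝ} {z : Cn n} (hf : ContDiffAt ℝ 2 f z) :
    ∀ᶠ y in 𝓝 z, DifferentiableAt ℝ f y :=
  (hf.eventually (by simp)).mono fun _ h => h.differentiableAt (by simp)

theorem fderiv_fderiv_add {f g : Cn n → ℝ} {z : Cn n} (hf : ContDiffAt ℝ 2 f z)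
    (hg : ContDiffAt ℝ 2 g z) :
    fderiv ℝ (fderiv ℝ fun y => f y + g y) z
      = fderiv ℝ (fderiv ℝ f) z + fderiv ℝ (fderiv ℝ g) z := by
  have h : fderiv ℝ (fun y => f y + g y) =ᶠ[𝓝 z] fun y => fderiv ℝ f y + fderiv ℝ g y := by
    filter_upwards [eventually_differentiableAt hf, eventually_differentiableAt hg] with y h1 h2
    exact fderiv_add h1 h2
  rw [h.fderiv_eq]
  exact fderiv_add ((contDiffAt_fderiv hf).differentiableAt (by simp))
    ((contDiffAt_fderiv hg).differentiableAt (by simp))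

theorem fderiv_fderiv_const_mul {f : Cn n → ℝ} {z : Cn n} (c : ℝ) (hf : ContDiffAt ℝ 2 f z) :
    fderiv ℝ (fderiv ℝ fun y => c * f y) z = c • fderiv ℝ (fderiv ℝ f) z := by
  have h : fderiv ℝ (fun y => c * f y) =ᶠ[𝓝 z] fun y => c • fderiv ℝ f y := by
    filter_upwards [eventually_differentiableAt hf] with y h1
    exact fderiv_const_mul h1 c
  rw [h.fderiv_eq]
  exact fderiv_const_smul ((contDiffAt_fderiv hf).differentiableAt (by simp)) c

theorem complexHessian_add {f g : Cn n → ℝ} {z : Cn n} (hf : ContDiffAt ℝ 2 f z)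
    (hg : ContDiffAt ℝ 2 g z) :
    complexHessian (fun y => f y + g y) z = complexHessian f z + complexHessian g z := by
  ext j k
  simp only [Matrix.add_apply, complexHessian_apply, hessSesq_apply, fderiv_fderiv_add hf hg,
    add_apply]
  push_cast
  ring

theorem complexHessian_const_mul {f : Cn n → ℝ} {z : Cn n} (c : ℝ) (hf : ContDiffAt ℝ 2 f z) :
    complexHessian (fun y => c * f y) z = (c : ℂ) • complexHessian f z := by
  ext j k
  simp only [Matrix.smul_apply, complexHessian_apply, hessSesq_apply,
    fderiv_fderiv_const_mul c hf, smul_apply, smul_eq_mul]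
  push_cast
  ring

theorem continuousAt_complexHessian {f : Cn n → ℝ} {z : Cn n} (hf : ContDiffAt ℝ 2 f z) :
    ContinuousAt (complexHessian f) z := by
  have h2 : ContinuousAt (fderiv ℝ (fderiv ℝ f)) z :=
    ((contDiffAt_fderiv hf).fderiv_right (m := 0) (by norm_num)).continuousAt
  have h3 : ∀ v w, ContinuousAt (fun y => ((fderiv ℝ (fderiv ℝ f) y v w : ℝ) : ℂ)) z := fun v w =>
    Complex.continuous_ofReal.continuousAt.comp
      ((h2.clm_apply continuousAt_const).clm_apply continuousAt_const)
  refine continuousAt_pi.mpr fun j => continuousAt_pi.mpr fun k => ?_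
  simp only [complexHessian]
  push_cast
  exact (((h3 _ _).add (h3 _ _)).add (continuousAt_const.mul ((h3 _ _).sub (h3 _ _)))).div_const _

/-- The second derivative test: at a local maximum the second derivative is nonpositive. -/
theorem fderiv_fderiv_nonpos_of_isLocalMax {f : Cn n → ℝ} {z : Cn n} (hf : ContDiffAt ℝ 2 f z)
    (hmax : IsLocalMax f z) (v : Cn n) : fderiv ℝ (fderiv ℝ f) z v v ≤ 0 := by
  set l : ℝ → Cn n := fun t => z + t • v with hl
  have hl0 : l 0 = z := by simp [hl]
  have hld : ∀ t, HasDerivAt l v t := fun t => by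
    simpa [hl] using ((hasDerivAt_id t).smul_const v).const_add z
  have hlc : ContinuousAt l 0 := (hld 0).continuousAt
  have hlt : Tendsto l (𝓝 0) (𝓝 z) := by simpa [ContinuousAt, hl0] using hlc
  have hd1 : deriv (f ∘ l) =ᶠ[𝓝 0] fun t => fderiv ℝ f (l t) v := by
    filter_upwards [hlt.eventually (eventually_differentiableAt hf)] with t ht
    exact (ht.hasFDerivAt.comp_hasDerivAt t (hld t)).deriv
  have hd2 : deriv (deriv (f ∘ l)) 0 = fderiv ℝ (fderiv ℝ f) z v v := by
    rw [hd1.deriv_eq]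
    have h := ((contDiffAt_fderiv hf).differentiableAt (by simp)).hasFDerivAt
    rw [← hl0] at h
    have h' := (h.comp_hasDerivAt (0 : ℝ) (hld 0)).clm_apply (hasDerivAt_const (0 : ℝ) v)
    rw [hl0] at h'
    simpa using h'.deriv
  have hmaxl : IsLocalMax (f ∘ l) 0 := by
    have := hlt.eventually hmax
    filter_upwards [this] with t ht
    simpa [hl0] using ht
  by_contra! hpos
  -- A positive second derivative makes `0` a local minimum as well, so `f ∘ l` is locally constant.
  have hmin : IsLocalMin (f ∘ l) 0 := by
    refine isLocalMin_of_deriv_deriv_pos (by rw [hd2]; exact hpos) hmaxl.deriv_eq_zero ?_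
    exact ContinuousAt.comp (by rw [hl0]; exact hf.continuousAt) hlc
  have hconst : f ∘ l =ᶠ[𝓝 0] fun _ => (f ∘ l) 0 := by
    filter_upwards [hmaxl, hmin] with t h1 h2
    exact le_antisymm h1 h2
  have := hconst.deriv.deriv_eq
  rw [hd2] at this
  simp at this
  exact hpos.ne' this

theorem complexHessian_neg_posSemidef_of_isLocalMax {f : Cn n → ℝ} {z : Cn n}
    (hf : ContDiffAt ℝ 2 f z) (hmax : IsLocalMax f z) : (-complexHessian f z).PosSemidef := by
  refine Matrix.PosSemidef.of_dotProduct_mulVec_nonneg (complexHessian_isHermitian hf).neg ?_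
  intro x
  rw [Matrix.neg_mulVec, dotProduct_neg, star_dotProduct_complexHessian_mulVec hf,
    ← Complex.ofReal_neg, Complex.zero_le_real]
  have h1 := fderiv_fderiv_nonpos_of_isLocalMax hf hmax (WithLp.toLp 2 (star x))
  have h2 := fderiv_fderiv_nonpos_of_isLocalMax hf hmax (Complex.I • WithLp.toLp 2 (star x))
  linarith

end ComplexHessian

/-! ### Changes of holomorphic charts -/

section Charts

variable {n : ℕ} {X : Type*} [TopologicalSpace X] [ChartedSpace (Cn n) X]

theorem contDiffGroupoid_complex_le_real :
    contDiffGroupoid ∞ 𝓘(ℂ, Cn n) ≤ contDiffGroupoid ∞ 𝓘(ℝ, Cn n) := by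
  rw [StructureGroupoid.le_iff]
  intro e he
  rw [contDiffGroupoid, mem_groupoid_of_pregroupoid] at he ⊢
  exact ⟨ContDiffOn.restrict_scalars ℝ he.1, ContDiffOn.restrict_scalars ℝ he.2⟩

variable {e e' : OpenPartialHomeomorph X (Cn n)}

theorem IsHolChart.mem_maximalAtlas_real (he : IsHolChart n e) :
    e ∈ IsManifold.maximalAtlas 𝓘(ℝ, Cn n) ∞ X := fun e' he' =>
  ⟨contDiffGroupoid_complex_le_real (he e' he').1, contDiffGroupoid_complex_le_real (he e' he').2⟩

theorem isHolChart_chartAt [IsManifold 𝓘(ℂ, Cn n) ∞ X] (x : X) :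
    IsHolChart n (chartAt (Cn n) x) :=
  IsManifold.chart_mem_maximalAtlas x

theorem IsHolChart.differentiableAt_transition (he : IsHolChart n e) (he' : IsHolChart n e')
    {z : Cn n} (hz : z ∈ e.target) (hz' : e.symm z ∈ e'.source) :
    DifferentiableAt ℂ (e' ∘ e.symm) z := by
  have h := StructureGroupoid.compatible_of_mem_maximalAtlas he he'
  rw [contDiffGroupoid, mem_groupoid_of_pregroupoid] at h
  have h1 : ContDiffOn ℂ ∞ (e' ∘ e.symm) (e.symm.trans e').source := by
    simpa [contDiffPregroupoid] using h.1
  have hmem : z ∈ (e.symm.trans e').source := by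
    rw [OpenPartialHomeomorph.trans_source]
    exact ⟨hz, hz'⟩
  exact (h1.contDiffAt ((e.symm.trans e').open_source.mem_nhds hmem)).differentiableAt (by simp)

theorem IsHolChart.mdifferentiableAt_symm (he : IsHolChart n e) {z : Cn n} (hz : z ∈ e.target) :
    MDifferentiableAt 𝓘(ℝ, Cn n) 𝓘(ℝ, Cn n) e.symm z :=
  ((contMDiffOn_symm_of_mem_maximalAtlas he.mem_maximalAtlas_real).contMDiffAt
    (e.open_target.mem_nhds hz)).mdifferentiableAt (by simp)

/-- The transformation rule of a 2-form under a change of holomorphic charts. -/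
theorem inChart_eq_compContinuousLinearMap (a : TwoForm n X) (he : IsHolChart n e)
    (he' : IsHolChart n e') {z : Cn n} (hz : z ∈ e.target) (hz' : e.symm z ∈ e'.source) :
    a.inChart e z
      = (a.inChart e' (e' (e.symm z))).compContinuousLinearMap (fderiv ℝ (e' ∘ e.symm) z) := by
  have hx : e'.symm (e' (e.symm z)) = e.symm z := e'.left_inv hz'
  have hd : MDifferentiableAt 𝓘(ℝ, Cn n) 𝓘(ℝ, Cn n) (e' ∘ e.symm) z :=
    ((he.differentiableAt_transition he' hz hz').restrictScalars ℝ).mdifferentiableAt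
  have hloc : e.symm =ᶠ[𝓝 z] e'.symm ∘ (e' ∘ e.symm) := by
    have h1 : ∀ᶠ y in 𝓝 z, e.symm y ∈ e'.source :=
      (e.symm.continuousAt hz).eventually (e'.open_source.mem_nhds hz')
    filter_upwards [h1] with y hy
    exact (e'.left_inv hy).symm
  have hcomp : mfderiv 𝓘(ℝ, Cn n) 𝓘(ℝ, Cn n) e.symm z
      = (mfderiv 𝓘(ℝ, Cn n) 𝓘(ℝ, Cn n) e'.symm (e' (e.symm z))).comp
          (mfderiv 𝓘(ℝ, Cn n) 𝓘(ℝ, Cn n) (e' ∘ e.symm) z) := by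
    rw [hloc.mfderiv_eq]
    exact mfderiv_comp z (he'.mdifferentiableAt_symm (e'.map_source hz')) hd
  have hfd : mfderiv 𝓘(ℝ, Cn n) 𝓘(ℝ, Cn n) (e' ∘ e.symm) z = fderiv ℝ (e' ∘ e.symm) z :=
    mfderiv_eq_fderiv
  have ha : ∀ (y y' : X) (h : y = y') (u : Fin 2 → Cn n),
      (a y : Cn n [⋀^Fin 2]→L[ℝ] ℝ) u = (a y' : Cn n [⋀^Fin 2]→L[ℝ] ℝ) u := by
    rintro y _ rfl u; rfl
  ext u
  refine (ha _ _ hx.symm _).trans ?_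
  have : ∀ v : Cn n, (mfderiv 𝓘(ℝ, Cn n) 𝓘(ℝ, Cn n) e.symm z : Cn n →L[ℝ] Cn n) v
      = (mfderiv 𝓘(ℝ, Cn n) 𝓘(ℝ, Cn n) e'.symm (e' (e.symm z)) : Cn n →L[ℝ] Cn n)
        (fderiv ℝ (e' ∘ e.symm) z v) := by
    intro v
    rw [← hfd]
    exact congrArg (fun L : Cn n →L[ℝ] Cn n => L v) hcomp
  refine congrArg (a (e'.symm (e' (e.symm z))) : Cn n [⋀^Fin 2]→L[ℝ] ℝ) ?_
  funext i
  exact this (u i)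

theorem IsHolChart.fderiv_transition_I_smul (he : IsHolChart n e) (he' : IsHolChart n e')
    {z : Cn n} (hz : z ∈ e.target) (hz' : e.symm z ∈ e'.source) (v : Cn n) :
    fderiv ℝ (e' ∘ e.symm) z (Complex.I • v) = Complex.I • fderiv ℝ (e' ∘ e.symm) z v := by
  rw [(he.differentiableAt_transition he' hz hz').fderiv_restrictScalars ℝ]
  simp

theorem KahlerForm.coeff_posDef (a : KahlerForm n X) (he : IsHolChart n e) {z : Cn n}
    (hz : z ∈ e.target) : (a.coeff e z).PosDef :=
  hermMatrix_posDef (a.type_one_one e he z hz) (a.positive e he z hz)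

theorem KahlerForm.continuousOn_coeff (a : KahlerForm n X) (he : IsHolChart n e) :
    ContinuousOn (a.coeff e) e.target := by
  have h := (a.smooth e he).continuousOn
  have h' : ∀ v w : Cn n,
      ContinuousOn (fun z => ((a.form.inChart e z ![v, w] : ℝ) : ℂ)) e.target := by
    intro v w
    refine Complex.continuous_ofReal.comp_continuousOn ?_
    exact (ContinuousEvalConst.continuous_eval_const
      (F := Cn n [⋀^Fin 2]→L[ℝ] ℝ) ![v, w]).comp_continuousOn h
  refine continuousOn_pi.mpr fun j => continuousOn_pi.mpr fun k => ?_
  exact ((h' _ _).sub (continuousOn_const.mul (h' _ _))).div_const _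

theorem Q_coeff_eq_trace (om chi : KahlerForm n X) (he : IsHolChart n e) {z : Cn n}
    (hz : z ∈ e.target) :
    Q (om.coeff e z) (chi.coeff e z) = ((chi.coeff e z)⁻¹ * om.coeff e z).trace.re :=
  Q_eq_trace (chi.coeff_posDef he hz) (om.coeff_posDef he hz)

theorem continuousAt_inv_of_det_ne_zero {A : Matrix (Fin n) (Fin n) ℂ} (hA : A.det ≠ 0) :
    ContinuousAt (fun B : Matrix (Fin n) (Fin n) ℂ => B⁻¹) A := by
  apply continuousAt_matrix_inv
  rw [Ring.inverse_eq_inv']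
  exact continuousAt_inv₀ hA

theorem continuousOn_Q_coeff (om chi : KahlerForm n X) (he : IsHolChart n e) :
    ContinuousOn (fun z => Q (om.coeff e z) (chi.coeff e z)) e.target := by
  suffices h : ContinuousOn (fun z => ((chi.coeff e z)⁻¹ * om.coeff e z).trace.re) e.target from
    h.congr fun z hz => Q_coeff_eq_trace om chi he hz
  have h3 : ContinuousOn (fun z => (chi.coeff e z)⁻¹) e.target := fun z hz =>
    ContinuousAt.comp_continuousWithinAt (g := fun B : Matrix (Fin n) (Fin n) ℂ => B⁻¹)
      (continuousAt_inv_of_det_ne_zero (chi.coeff_posDef he hz).det_pos.ne')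
      (chi.continuousOn_coeff he z hz)
  have hm : Continuous fun p : Matrix (Fin n) (Fin n) ℂ × Matrix (Fin n) (Fin n) ℂ =>
      (p.1 * p.2).trace.re :=
    Complex.continuous_re.comp (continuous_fst.matrix_mul continuous_snd).matrix_trace
  have h5 : ContinuousOn (fun z => ((chi.coeff e z)⁻¹, om.coeff e z)) e.target :=
    h3.prodMk (om.continuousOn_coeff he)
  have h6 := hm.comp_continuousOn h5
  exact h6

theorem contDiffOn_comp_symm {psi : X → ℝ} (hpsi : ContMDiff 𝓘(ℝ, Cn n) 𝓘(ℝ, ℝ) ∞ psi)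
    (he : IsHolChart n e) : ContDiffOn ℝ ∞ (fun w => psi (e.symm w)) e.target :=
  (hpsi.comp_contMDiffOn
    (contMDiffOn_symm_of_mem_maximalAtlas he.mem_maximalAtlas_real)).contDiffOn

variable [IsManifold 𝓘(ℂ, Cn n) ∞ X]

/-- `Q_ω(χ)` may be computed in any holomorphic chart. -/
theorem Qform_symm_apply (om chi : KahlerForm n X) (he : IsHolChart n e) {z : Cn n}
    (hz : z ∈ e.target) : Qform om chi (e.symm z) = Q (om.coeff e z) (chi.coeff e z) := by
  set e' := chartAt (Cn n) (e.symm z)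
  have he' : IsHolChart n e' := isHolChart_chartAt _
  have hz' : e.symm z ∈ e'.source := mem_chart_source _ _
  have hw : e' (e.symm z) ∈ e'.target := e'.map_source hz'
  have key : ∀ a : KahlerForm n X, a.coeff e z = _ := fun a => by
    unfold KahlerForm.coeff
    rw [inChart_eq_compContinuousLinearMap a.form he he' hz hz',
      hermMatrix_compContinuousLinearMap (a.type_one_one e' he' _ hw) _
        (he.fderiv_transition_I_smul he' hz hz')]
  have h1 := om.coeff_posDef he hz
  have h2 := chi.coeff_posDef he hz
  rw [key om, key chi]
  rw [key om] at h1
  rw [key chi] at h2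
  exact (Q_conjTranspose_mul_mul (chi.coeff_posDef he' hw) (om.coeff_posDef he' hw) h2 h1).symm

theorem continuous_Qform (om chi : KahlerForm n X) : Continuous (Qform om chi) := by
  rw [continuous_iff_continuousAt]
  intro x
  set e := chartAt (Cn n) x
  have he : IsHolChart n e := isHolChart_chartAt _
  have hx : x ∈ e.source := mem_chart_source _ _
  have h1 : ContinuousAt (fun z => Q (om.coeff e z) (chi.coeff e z)) (e x) :=
    (continuousOn_Q_coeff om chi he).continuousAt (e.open_target.mem_nhds (e.map_source hx))
  refine (h1.comp (e.continuousAt hx)).congr ?_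
  filter_upwards [e.open_source.mem_nhds hx] with y hy
  have := Qform_symm_apply om chi he (e.map_source hy)
  rw [e.left_inv hy] at this
  exact this.symm

end Charts

/-! ### The volume measure in a chart -/

section Volume

variable {n : ℕ} {X : Type*} [TopologicalSpace X] [ChartedSpace (Cn n) X]
  {e : OpenPartialHomeomorph X (Cn n)}

theorem KahlerForm.exists_pos_le_det (om : KahlerForm n X) (he : IsHolChart n e)
    {K : Set (Cn n)} (hK : IsCompact K) (hKe : K ⊆ e.target) :
    ∃ m : ℝ, 0 < m ∧ ∀ z ∈ K, m ≤ (om.coeff e z).det.re := by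
  rcases K.eq_empty_or_nonempty with rfl | hne
  · exact ⟨1, one_pos, by simp⟩
  have hc : ContinuousOn (fun z => (om.coeff e z).det.re) K := by
    have h1 : Continuous fun A : Matrix (Fin n) (Fin n) ℂ => A.det.re :=
      Complex.continuous_re.comp continuous_id.matrix_det
    exact h1.comp_continuousOn ((om.continuousOn_coeff he).mono hKe)
  obtain ⟨z, hz, hmin⟩ := hK.exists_isMinOn hne hc
  exact ⟨_, (Complex.lt_def.mp (om.coeff_posDef he (hKe hz)).det_pos).1, fun y hy => hmin hy⟩

variable [MeasurableSpace X] [BorelSpace X]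

/-- The expression in the chart `e` of the volume measure of `ω`, as a measure on `ℂⁿ`. -/
noncomputable def KahlerForm.chartVol (om : KahlerForm n X)
    (e : OpenPartialHomeomorph X (Cn n)) : Measure (Cn n) :=
  ((volume : Measure (Cn n)).restrict e.target).withDensity
    (fun z => 2 ^ n * ENNReal.ofReal (om.coeff e z).det.re)

omit [BorelSpace X] in
theorem KahlerForm.map_chartVol_le_vol (om : KahlerForm n X) (he : IsHolChart n e) :
    (om.chartVol e).map e.symm ≤ om.vol :=
  le_iSup₂ (f := fun (e : OpenPartialHomeomorph X (Cn n)) (_ : IsHolChart n e) =>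
    (om.chartVol e).map e.symm) e he

theorem KahlerForm.aemeasurable_symm (om : KahlerForm n X) :
    AEMeasurable e.symm (om.chartVol e) :=
  (e.continuousOn_symm.aemeasurable e.open_target.measurableSet).mono_ac
    (withDensity_absolutelyContinuous _ _)

omit [MeasurableSpace X] [BorelSpace X] in
theorem KahlerForm.exists_restrict_le_smul_chartVol (om : KahlerForm n X) (he : IsHolChart n e)
    {K : Set (Cn n)} (hK : IsCompact K) (hKe : K ⊆ e.target) :
    ∃ C : ENNReal, C ≠ ⊤ ∧ (volume : Measure (Cn n)).restrict K ≤ C • om.chartVol e := by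
  obtain ⟨m, hm, hmK⟩ := om.exists_pos_le_det he hK hKe
  have hm0 : ENNReal.ofReal m ≠ 0 := by simpa using hm
  refine ⟨(ENNReal.ofReal m)⁻¹, ENNReal.inv_ne_top.mpr hm0, ?_⟩
  have hKm : MeasurableSet K := hK.measurableSet
  have h1 : ENNReal.ofReal m • (volume : Measure (Cn n)).restrict K ≤ om.chartVol e := by
    calc ENNReal.ofReal m • (volume : Measure (Cn n)).restrict K
        = ((volume : Measure (Cn n)).restrict K).withDensity fun _ => ENNReal.ofReal m :=
          (withDensity_const _).symm
      _ ≤ ((volume : Measure (Cn n)).restrict K).withDensity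
            (fun z => 2 ^ n * ENNReal.ofReal (om.coeff e z).det.re) := by
          refine withDensity_mono ?_
          filter_upwards [ae_restrict_mem hKm] with z hz
          calc ENNReal.ofReal m ≤ 1 * ENNReal.ofReal (om.coeff e z).det.re := by
                rw [one_mul]; exact ENNReal.ofReal_le_ofReal (hmK z hz)
            _ ≤ _ := by gcongr; exact one_le_pow₀ (by norm_num)
      _ = (om.chartVol e).restrict K := by
          rw [KahlerForm.chartVol, restrict_withDensity hKm, Measure.restrict_restrict hKm,
            Set.inter_eq_left.mpr hKe]
      _ ≤ _ := Measure.restrict_le_self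
  calc (volume : Measure (Cn n)).restrict K
      = (ENNReal.ofReal m)⁻¹ • (ENNReal.ofReal m • (volume : Measure (Cn n)).restrict K) := by
        rw [smul_smul, ENNReal.inv_mul_cancel hm0 ENNReal.ofReal_ne_top, one_smul]
    _ ≤ _ := by gcongr

theorem KahlerForm.aestronglyMeasurable_comp_symm (om : KahlerForm n X) (he : IsHolChart n e)
    {K : Set (Cn n)} (hK : IsCompact K) (hKe : K ⊆ e.target) {f : X → ℝ}
    (hf : AEStronglyMeasurable f om.vol) :
    AEStronglyMeasurable (fun z => f (e.symm z)) ((volume : Measure (Cn n)).restrict K) := by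
  obtain ⟨C, -, hle⟩ := om.exists_restrict_le_smul_chartVol he hK hKe
  have h1 : AEStronglyMeasurable (f ∘ e.symm) (om.chartVol e) :=
    (hf.mono_measure (om.map_chartVol_le_vol he)).comp_aemeasurable om.aemeasurable_symm
  exact h1.mono_ac (Measure.absolutelyContinuous_of_le_smul hle)

/-- Convergence in `L^p(ω)` with `p ≥ 1` implies convergence in `L¹` of the expressions in a chart,
on each compact subset of the chart. -/
theorem KahlerForm.tendsto_eLpNorm_comp_symm (om : KahlerForm n X) (he : IsHolChart n e)
    {K : Set (Cn n)} (hK : IsCompact K) (hKe : K ⊆ e.target) {p : ENNReal} (hp : 1 ≤ p)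
    (hp' : p ≠ ⊤) {f : ℕ → X → ℝ} (hf : ∀ k, AEStronglyMeasurable (f k) om.vol)
    (hlim : Tendsto (fun k => eLpNorm (f k) p om.vol) atTop (𝓝 0)) :
    Tendsto (fun k => eLpNorm (fun z => f k (e.symm z)) 1 ((volume : Measure (Cn n)).restrict K))
      atTop (𝓝 0) := by
  obtain ⟨C, hC, hle⟩ := om.exists_restrict_le_smul_chartVol he hK hKe
  set D : ENNReal := (volume.restrict K : Measure (Cn n)) Set.univ
    ^ (1 / (1 : ENNReal).toReal - 1 / p.toReal) with hD
  have hp1 : 1 ≤ p.toReal := by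
    rw [← ENNReal.toReal_one]; exact (ENNReal.toReal_le_toReal ENNReal.one_ne_top hp').mpr hp
  have hDtop : D ≠ ⊤ := by
    refine ENNReal.rpow_ne_top_of_nonneg ?_ ?_
    · rw [ENNReal.toReal_one, div_one, sub_nonneg, div_le_one (by linarith)]
      exact hp1
    · rw [Measure.restrict_apply_univ]; exact hK.measure_lt_top.ne
  have hCtop : C ^ (1 / p).toReal ≠ ⊤ := ENNReal.rpow_ne_top_of_nonneg ENNReal.toReal_nonneg hC
  have hbound : ∀ k,
      eLpNorm (fun z => f k (e.symm z)) 1 ((volume : Measure (Cn n)).restrict K)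
        ≤ C ^ (1 / p).toReal * eLpNorm (f k) p om.vol * D := by
    intro k
    refine (eLpNorm_le_eLpNorm_mul_rpow_measure_univ hp
      (om.aestronglyMeasurable_comp_symm he hK hKe (hf k))).trans ?_
    gcongr
    calc eLpNorm (fun z => f k (e.symm z)) p ((volume : Measure (Cn n)).restrict K)
        ≤ eLpNorm (f k ∘ e.symm) p (C • om.chartVol e) := eLpNorm_mono_measure _ hle
      _ = C ^ (1 / p).toReal * eLpNorm (f k ∘ e.symm) p (om.chartVol e) := by
          rw [eLpNorm_smul_measure_of_ne_top hp', smul_eq_mul]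
      _ ≤ _ := by
          gcongr
          rw [← eLpNorm_map_measure ((hf k).mono_measure (om.map_chartVol_le_vol he))
            om.aemeasurable_symm]
          exact eLpNorm_mono_measure _ (om.map_chartVol_le_vol he)
  have hlim' : Tendsto (fun k => C ^ (1 / p).toReal * eLpNorm (f k) p om.vol * D) atTop (𝓝 0) := by
    have h1 := ENNReal.Tendsto.const_mul (a := C ^ (1 / p).toReal) hlim (Or.inr hCtop)
    have h2 := ENNReal.Tendsto.mul_const (b := D) h1 (Or.inr hDtop)
    simpa using h2
  exact tendsto_of_tendsto_of_tendsto_of_le_of_le tendsto_const_nhds hlim' (fun _ => zero_le)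
    hbound

end Volume

/-- If functions converge in `L¹` on a compact set, then their integrals against a continuous
function which vanishes off this set converge. The limit function is not assumed to be integrable. -/
theorem tendsto_integral_mul_of_tendsto_eLpNorm_restrict {E : Type*} [TopologicalSpace E]
    [MeasurableSpace E] [BorelSpace E] {μ : Measure E} {𝕜 : Type*} [RCLike 𝕜] {K : Set E}
    (hK : IsCompact K) (hKm : MeasurableSet K) {g : E → 𝕜} (hg : Continuous g)
    (hgK : ∀ z ∉ K, g z = 0) {F : ℕ → E → ℝ} {f : E → ℝ}
    (hF : ∀ k, IntegrableOn (F k) K μ) (hf : AEStronglyMeasurable f (μ.restrict K))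
    (hlim : Tendsto (fun k => eLpNorm (fun z => F k z - f z) 1 (μ.restrict K)) atTop (𝓝 0)) :
    Tendsto (fun k => ∫ z, (F k z : 𝕜) * g z ∂μ) atTop (𝓝 (∫ z, (f z : 𝕜) * g z ∂μ)) := by
  have hset : ∀ h : E → ℝ, ∫ z, (h z : 𝕜) * g z ∂μ = ∫ z in K, (h z : 𝕜) * g z ∂μ := fun h =>
    (setIntegral_eq_integral_of_forall_compl_eq_zero fun z hz => by simp [hgK z hz]).symm
  simp only [hset]
  obtain ⟨C, hC⟩ := hK.exists_bound_of_continuousOn hg.continuousOn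
  have hg' : AEStronglyMeasurable g (μ.restrict K) :=
    (hg.continuousOn.aestronglyMeasurable_of_isCompact hK hKm)
  have hgb : ∀ᵐ z ∂μ.restrict K, ‖g z‖ ≤ C := by
    filter_upwards [ae_restrict_mem hKm] with z hz using hC z hz
  refine tendsto_integral_of_L1 (fun z => (f z : 𝕜) * g z)
    ((RCLike.continuous_ofReal.comp_aestronglyMeasurable hf).mul hg')
    (Eventually.of_forall fun k => ((hF k).ofReal (𝕜 := 𝕜)).mul_bdd hg' hgb) ?_
  have hlim' : Tendsto (fun k => ENNReal.ofReal C * eLpNorm (fun z => F k z - f z) 1 (μ.restrict K))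
      atTop (𝓝 0) := by
    simpa using ENNReal.Tendsto.const_mul (a := ENNReal.ofReal C) hlim
      (Or.inr ENNReal.ofReal_ne_top)
  refine tendsto_of_tendsto_of_tendsto_of_le_of_le tendsto_const_nhds hlim' (fun _ => zero_le)
    fun k => ?_
  simp only
  rw [eLpNorm_one_eq_lintegral_enorm, ← lintegral_const_mul' _ _ ENNReal.ofReal_ne_top]
  refine lintegral_mono_ae ?_
  filter_upwards [hgb] with z hz
  rw [← sub_mul, enorm_mul, mul_comm, ← RCLike.ofReal_sub]
  gcongr
  · rw [← ofReal_norm]; exact ENNReal.ofReal_le_ofReal hz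
  · rw [← ofReal_norm, ← ofReal_norm, RCLike.norm_ofReal, Real.norm_eq_abs]

/-! ### Integration by parts -/

section IntegrationByParts

variable {n : ℕ}

theorem two_le_infty : (2 : ℕ∞ω) ≤ ∞ :=
  WithTop.coe_le_coe.mpr (le_top : (2 : ℕ∞) ≤ ⊤)

theorem integrable_mul_of_tsupport_subset {𝕜 : Type*} [RCLike 𝕜] {f g : Cn n → 𝕜}
    {U : Set (Cn n)} (hf : ContinuousOn f U) (hg : Continuous g) (hgc : HasCompactSupport g)
    (hgU : tsupport g ⊆ U) : Integrable fun z => f z * g z := by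
  have h1 : IntegrableOn (fun z => f z * g z) (tsupport g) :=
    ((hf.mono hgU).mul hg.continuousOn).integrableOn_compact hgc
  refine (integrableOn_iff_integrable_of_support_subset ?_).mp h1
  intro z hz
  exact subset_tsupport g fun h => hz (by simp [h])

variable {U : Set (Cn n)} {eta : Cn n → ℝ}

theorem tsupport_fderiv_apply_subset (f : Cn n → ℝ) (v : Cn n) :
    tsupport (fun z => fderiv ℝ f z v) ⊆ tsupport f :=
  closure_minimal (fun z hz => support_fderiv_subset ℝ (f := f) fun h => hz (by simp [h]))
    (isClosed_tsupport _)

theorem IsTestOn.fderiv_apply (h : IsTestOn eta U) (v : Cn n) :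
    IsTestOn (fun z => fderiv ℝ eta z v) U :=
  ⟨(h.1.fderiv_right (m := ∞) (by simp)).clm_apply contDiff_const,
    h.2.1.mono' ((subset_tsupport _).trans (tsupport_fderiv_apply_subset eta v)),
    (tsupport_fderiv_apply_subset eta v).trans h.2.2⟩

theorem IsTestOn.integral_mul_fderiv {f : Cn n → ℝ} (hU : IsOpen U) (h : IsTestOn eta U)
    (hf : ContDiffOn ℝ ∞ f U) (v : Cn n) :
    ∫ z, f z * fderiv ℝ eta z v = -∫ z, fderiv ℝ f z v * eta z := by
  have hd : ContinuousOn (fun z => fderiv ℝ f z v) U :=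
    (hf.continuousOn_fderiv_of_isOpen hU (by simp)).clm_apply continuousOn_const
  refine integral_mul_fderiv_eq_neg_fderiv_mul_of_integrable
    (integrable_mul_of_tsupport_subset hd h.1.continuous h.2.1 h.2.2)
    (integrable_mul_of_tsupport_subset hf.continuousOn (h.fderiv_apply v).1.continuous
      (h.fderiv_apply v).2.1 (h.fderiv_apply v).2.2)
    (integrable_mul_of_tsupport_subset hf.continuousOn h.1.continuous h.2.1 h.2.2)
    (fun z hz => (hf.contDiffAt (hU.mem_nhds (h.2.2 hz))).differentiableAt (by simp))
    (fun z _ => h.1.differentiable (by simp) z)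

theorem fderiv_fderiv_apply {f : Cn n → ℝ} {z : Cn n} (hf : ContDiffAt ℝ 2 f z) (v w : Cn n) :
    fderiv ℝ (fun y => fderiv ℝ f y w) z v = fderiv ℝ (fderiv ℝ f) z v w := by
  rw [fderiv_clm_apply ((contDiffAt_fderiv hf).differentiableAt (by simp))
    (differentiableAt_const w)]
  simp

theorem IsTestOn.contDiffAt (h : IsTestOn eta U) (z : Cn n) : ContDiffAt ℝ 2 eta z :=
  h.1.contDiffAt.of_le (two_le_infty)

theorem IsTestOn.integral_mul_fderiv_fderiv {f : Cn n → ℝ} (hU : IsOpen U) (h : IsTestOn eta U)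
    (hf : ContDiffOn ℝ ∞ f U) (v w : Cn n) :
    ∫ z, f z * fderiv ℝ (fderiv ℝ eta) z v w = ∫ z, fderiv ℝ (fderiv ℝ f) z v w * eta z := by
  have hsym : ∀ z, fderiv ℝ (fderiv ℝ eta) z v w
      = fderiv ℝ (fun y => fderiv ℝ eta y v) z w := fun z => by
    rw [fderiv_fderiv_apply (h.contDiffAt z)]
    exact (h.contDiffAt z).isSymmSndFDerivAt (by simp) v w
  have hfw : ContDiffOn ℝ ∞ (fun z => fderiv ℝ f z w) U :=
    (hf.fderiv_of_isOpen hU (m := ∞) (by simp)).clm_apply contDiffOn_const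
  simp only [hsym]
  rw [(h.fderiv_apply v).integral_mul_fderiv hU hf, h.integral_mul_fderiv hU hfw, neg_neg]
  refine integral_congr_ae (Eventually.of_forall fun z => ?_)
  by_cases hz : z ∈ U
  · simp only
    rw [fderiv_fderiv_apply ((hf.contDiffAt (hU.mem_nhds hz)).of_le (two_le_infty))]
  · simp [image_eq_zero_of_notMem_tsupport fun hz' => hz (h.2.2 hz')]

theorem continuousOn_fderiv_fderiv_apply {f : Cn n → ℝ} (hU : IsOpen U)
    (hf : ContDiffOn ℝ ∞ f U) (v w : Cn n) :
    ContinuousOn (fun z => fderiv ℝ (fderiv ℝ f) z v w) U :=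
  (((hf.fderiv_of_isOpen hU (m := ∞) (by simp)).continuousOn_fderiv_of_isOpen hU
    (by simp)).clm_apply continuousOn_const).clm_apply continuousOn_const

theorem continuousOn_complexHessian {f : Cn n → ℝ} (hU : IsOpen U) (hf : ContDiffOn ℝ ∞ f U) :
    ContinuousOn (complexHessian f) U := fun _ hz =>
  (continuousAt_complexHessian ((hf.contDiffAt (hU.mem_nhds hz)).of_le
    (two_le_infty))).continuousWithinAt

theorem tsupport_complexHessian_subset (f : Cn n → ℝ) (j k : Fin n) :
    tsupport (fun z => complexHessian f z j k) ⊆ tsupport f := by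
  refine closure_minimal (fun z hz => ?_) (isClosed_tsupport _)
  by_contra h
  apply hz
  have h2 : fderiv ℝ (fderiv ℝ f) z = 0 := by
    by_contra h3
    exact h (tsupport_fderiv_subset ℝ (support_fderiv_subset ℝ h3))
  simp [complexHessian, h2]

theorem IsTestOn.continuous_complexHessian (h : IsTestOn eta U) :
    Continuous (complexHessian eta) :=
  continuous_iff_continuousAt.mpr fun z => continuousAt_complexHessian (h.contDiffAt z)

/-- The complex number formed by the four real second derivatives in an entry of the complex
Hessian, integrated. -/
theorem integral_hessian_entry {a b c d : Cn n → ℝ} (ha : Integrable a) (hb : Integrable b)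
    (hc : Integrable c) (hd : Integrable d) :
    ∫ z, (((a z + b z : ℝ) : ℂ) + Complex.I * ((c z - d z : ℝ) : ℂ)) / 4
      = (((∫ z, a z) + ∫ z, b z : ℝ) + Complex.I * (((∫ z, c z) - ∫ z, d z : ℝ) : ℂ)) / 4 := by
  have i1 : Integrable fun z => ((a z + b z : ℝ) : ℂ) := (ha.add hb).ofReal
  have i2 : Integrable fun z => Complex.I * ((c z - d z : ℝ) : ℂ) :=
    (hc.sub hd).ofReal.const_mul _
  rw [integral_div, integral_add i1 i2, integral_const_mul, integral_complex_ofReal,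
    integral_complex_ofReal, integral_add ha hb, integral_sub hc hd]

theorem ddbarCurrent_apply {f : Cn n → ℝ}
    (hi : ∀ v w, Integrable fun z => f z * fderiv ℝ (fderiv ℝ eta) z v w) (j k : Fin n) :
    ddbarCurrent f eta j k
      = (((∫ z, f z * fderiv ℝ (fderiv ℝ eta) z (stdVec j) (stdVec k))
        + ∫ z, f z * fderiv ℝ (fderiv ℝ eta) z (Complex.I • stdVec j) (Complex.I • stdVec k) : ℝ)
        + Complex.I *
          (((∫ z, f z * fderiv ℝ (fderiv ℝ eta) z (stdVec j) (Complex.I • stdVec k))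
          - ∫ z, f z * fderiv ℝ (fderiv ℝ eta) z (Complex.I • stdVec j) (stdVec k) : ℝ) : ℂ))
        / 4 := by
  rw [← integral_hessian_entry (hi _ _) (hi _ _) (hi _ _) (hi _ _)]
  unfold ddbarCurrent
  refine integral_congr_ae (Eventually.of_forall fun z => ?_)
  simp only [complexHessian]
  push_cast
  ring

theorem IsTestOn.fderiv_fderiv_apply (h : IsTestOn eta U) (v w : Cn n) :
    IsTestOn (fun z => fderiv ℝ (fderiv ℝ eta) z v w) U := by
  have e : (fun z => fderiv ℝ (fderiv ℝ eta) z v w)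
      = fun z => fderiv ℝ (fun y => fderiv ℝ eta y w) z v := by
    funext z; rw [KahlerVisc.fderiv_fderiv_apply (h.contDiffAt z)]
  rw [e]
  exact (h.fderiv_apply w).fderiv_apply v

/-- For smooth functions, the current `√-1 ∂∂̄ f` is given by the complex Hessian of `f`. -/
theorem IsTestOn.ddbarCurrent_eq {f : Cn n → ℝ} (hU : IsOpen U) (h : IsTestOn eta U)
    (hf : ContDiffOn ℝ ∞ f U) (j k : Fin n) :
    ddbarCurrent f eta j k = ∫ z, complexHessian f z j k * (eta z : ℂ) := by
  have hi2 : ∀ v w, Integrable fun z => fderiv ℝ (fderiv ℝ f) z v w * eta z := fun v w =>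
    integrable_mul_of_tsupport_subset (continuousOn_fderiv_fderiv_apply hU hf v w)
      h.1.continuous h.2.1 h.2.2
  rw [ddbarCurrent_apply fun v w => integrable_mul_of_tsupport_subset hf.continuousOn
    (h.fderiv_fderiv_apply v w).1.continuous (h.fderiv_fderiv_apply v w).2.1
    (h.fderiv_fderiv_apply v w).2.2]
  simp only [h.integral_mul_fderiv_fderiv hU hf]
  rw [← integral_hessian_entry (hi2 _ _) (hi2 _ _) (hi2 _ _) (hi2 _ _)]
  refine integral_congr_ae (Eventually.of_forall fun z => ?_)
  simp only [complexHessian]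
  push_cast
  ring

end IntegrationByParts

/-! ### Averages of matrix-valued functions -/

section Smear

open scoped Matrix

variable {n : ℕ}

/-- The integral of a matrix-valued function against a test function. -/
noncomputable def smear (G : Cn n → Matrix (Fin n) (Fin n) ℂ) (eta : Cn n → ℝ) :
    Matrix (Fin n) (Fin n) ℂ :=
  Matrix.of fun j k => ∫ z, G z j k * (eta z : ℂ)

variable {U : Set (Cn n)} {eta : Cn n → ℝ} {G : Cn n → Matrix (Fin n) (Fin n) ℂ}

theorem IsTestOn.integrable_entry_mul (h : IsTestOn eta U) (hG : ContinuousOn G U) (j k : Fin n) :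
    Integrable fun z => G z j k * (eta z : ℂ) := by
  have hts : tsupport (fun z => (eta z : ℂ)) ⊆ tsupport eta :=
    closure_mono fun z hz h0 => hz (by simp [h0])
  exact integrable_mul_of_tsupport_subset
    (continuousOn_pi.mp (continuousOn_pi.mp hG j) k)
    (Complex.continuous_ofReal.comp h.1.continuous)
    (h.2.1.comp_left Complex.ofReal_zero) (hts.trans h.2.2)

theorem IsTestOn.sum_mul_smear (h : IsTestOn eta U) (hG : ContinuousOn G U)
    (w : Fin n → Fin n → ℂ) :
    ∑ j, ∑ k, w j k * smear G eta j k = ∫ z, (∑ j, ∑ k, w j k * G z j k) * (eta z : ℂ) := by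
  have hint := h.integrable_entry_mul hG
  simp only [Finset.sum_mul, mul_assoc]
  rw [integral_finsetSum _ fun j _ => integrable_finsetSum _ fun k _ => (hint j k).const_mul _]
  refine Finset.sum_congr rfl fun j _ => ?_
  rw [integral_finsetSum _ fun k _ => (hint j k).const_mul _]
  refine Finset.sum_congr rfl fun k _ => ?_
  rw [integral_const_mul]
  rfl

theorem IsTestOn.integrable_sum_mul (h : IsTestOn eta U) (hG : ContinuousOn G U)
    (w : Fin n → Fin n → ℂ) :
    Integrable fun z => (∑ j, ∑ k, w j k * G z j k) * (eta z : ℂ) := by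
  simp only [Finset.sum_mul, mul_assoc]
  exact integrable_finsetSum _ fun j _ => integrable_finsetSum _ fun k _ =>
    (h.integrable_entry_mul hG j k).const_mul _

theorem IsTestOn.smear_posSemidef (h : IsTestOn eta U) (hG : ContinuousOn G U)
    (hpos : ∀ z, 0 ≤ eta z) (hGpos : ∀ z ∈ U, (G z).PosSemidef) : (smear G eta).PosSemidef := by
  have hz : ∀ z, z ∉ U → eta z = 0 := fun z hz =>
    image_eq_zero_of_notMem_tsupport fun hz' => hz (h.2.2 hz')
  refine Matrix.PosSemidef.of_dotProduct_mulVec_nonneg ?_ fun x => ?_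
  · ext j k
    rw [Matrix.conjTranspose_apply]
    simp only [smear, Matrix.of_apply]
    rw [Complex.star_def, ← integral_conj]
    refine integral_congr_ae (Eventually.of_forall fun z => ?_)
    by_cases hzU : z ∈ U
    · simp only [map_mul, Complex.conj_ofReal]
      rw [← Complex.star_def, (hGpos z hzU).1.apply j k]
    · simp [hz z hzU]
  · rw [star_dotProduct_mulVec_eq_sum, h.sum_mul_smear hG]
    have e : ∀ z, (∑ j, ∑ k, star (x j) * star (star (x k)) * G z j k) * (eta z : ℂ)
        = (((star x ⬝ᵥ (G z *ᵥ x)).re * eta z : ℝ) : ℂ) := by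
      intro z
      rw [← star_dotProduct_mulVec_eq_sum]
      by_cases hzU : z ∈ U
      · have him := (Complex.le_def.mp ((hGpos z hzU).dotProduct_mulVec_nonneg x)).2
        apply Complex.ext
        · simp
        · simp [← him]
      · simp [hz z hzU]
    simp only [e]
    rw [integral_complex_ofReal, Complex.zero_le_real]
    refine integral_nonneg fun z => ?_
    by_cases hzU : z ∈ U
    · exact mul_nonneg (Complex.le_def.mp ((hGpos z hzU).dotProduct_mulVec_nonneg x)).1 (hpos z)
    · simp [hz z hzU]

theorem dualQ_eq_sum (B Z A : Matrix (Fin n) (Fin n) ℂ) :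
    dualQ B Z A = 2 * (Z * B).trace.re - (∑ j, ∑ k, (Z * B * Zᴴ) k j * A j k).re := by
  have : (Zᴴ * A * Z * B).trace = ∑ j, ∑ k, (Z * B * Zᴴ) k j * A j k := by
    rw [Matrix.mul_assoc, Matrix.mul_assoc, Matrix.trace_mul_comm, Matrix.mul_assoc, Matrix.trace]
    refine Finset.sum_congr rfl fun j _ => ?_
    rw [Matrix.diag_apply, Matrix.mul_apply]
    exact Finset.sum_congr rfl fun k _ => mul_comm _ _
  rw [dualQ, this]

theorem continuous_dualQ (B Z : Matrix (Fin n) (Fin n) ℂ) : Continuous (dualQ B Z) := by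
  unfold dualQ
  refine continuous_const.sub (Complex.continuous_re.comp (Continuous.matrix_trace ?_))
  exact ((continuous_const.matrix_mul continuous_id).matrix_mul continuous_const).matrix_mul
    continuous_const

/-- Jensen's inequality for the affine functions `dualQ B Z`. -/
theorem IsTestOn.dualQ_smear_le (h : IsTestOn eta U) (hG : ContinuousOn G U)
    (hpos : ∀ z, 0 ≤ eta z) (hint : ∫ z, eta z = 1) {B Z : Matrix (Fin n) (Fin n) ℂ}
    {b : Cn n → ℝ} (hb : ContinuousOn b U) (hle : ∀ z ∈ tsupport eta, dualQ B Z (G z) ≤ b z) :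
    dualQ B Z (smear G eta) ≤ ∫ z, b z * eta z := by
  have hi1 : Integrable eta := h.1.continuous.integrable_of_hasCompactSupport h.2.1
  have hi2 := h.integrable_sum_mul hG fun j k => (Z * B * Zᴴ) k j
  have hi2' : Integrable fun z => (∑ j, ∑ k, (Z * B * Zᴴ) k j * G z j k).re * eta z := by
    simpa using hi2.re
  have e : dualQ B Z (smear G eta) = ∫ z, dualQ B Z (G z) * eta z := by
    simp only [dualQ_eq_sum, sub_mul]
    rw [integral_sub (hi1.const_mul _) hi2', integral_const_mul, hint, mul_one,
      h.sum_mul_smear hG]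
    congr 1
    rw [← RCLike.re_eq_complex_re, ← integral_re hi2]
    simp
  rw [e]
  refine integral_mono ?_ (integrable_mul_of_tsupport_subset hb h.1.continuous h.2.1 h.2.2)
    fun z => ?_
  · simp only [dualQ_eq_sum, sub_mul]
    exact (hi1.const_mul _).sub hi2'
  · by_cases hz : z ∈ tsupport eta
    · exact mul_le_mul_of_nonneg_right (hle z hz) (hpos z)
    · simp [image_eq_zero_of_notMem_tsupport hz]

/-- Positive definiteness is an open condition on Hermitian matrices, by compactness of the unit
sphere. -/
theorem eventually_posSemidef {E : Type*} [TopologicalSpace E]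
    {G : E → Matrix (Fin n) (Fin n) ℂ} {z₀ : E} (hG : ContinuousAt G z₀)
    (hherm : ∀ᶠ z in 𝓝 z₀, (G z).IsHermitian) (hpos : (G z₀).PosDef) :
    ∀ᶠ z in 𝓝 z₀, (G z).PosSemidef := by
  have hcont : Continuous fun p : Matrix (Fin n) (Fin n) ℂ × (Fin n → ℂ) =>
      (star p.2 ⬝ᵥ (p.1 *ᵥ p.2)).re := by
    refine Complex.continuous_re.comp ?_
    exact continuous_snd.star.dotProduct (continuous_fst.matrix_mulVec continuous_snd)
  have h1 : ∀ᶠ A in 𝓝 (G z₀), ∀ x ∈ Metric.sphere (0 : Fin n → ℂ) 1,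
      0 < (star x ⬝ᵥ (A *ᵥ x)).re := by
    refine (isCompact_sphere _ _).eventually_forall_of_forall_eventually fun x hx => ?_
    refine hcont.continuousAt.eventually (lt_mem_nhds ?_)
    refine (Complex.lt_def.mp (hpos.dotProduct_mulVec_pos ?_)).1
    rintro rfl
    simp at hx
  filter_upwards [hG.eventually h1, hherm] with z hz hzh
  refine Matrix.PosSemidef.of_dotProduct_mulVec_nonneg hzh fun x => ?_
  rw [Complex.le_def]
  refine ⟨?_, (hzh.im_star_dotProduct_mulVec_self x).symm⟩
  by_cases hx : x = 0
  · simp [hx]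
  have hx' : 0 < ‖x‖ := norm_pos_iff.mpr hx
  have h2 := hz ((‖x‖⁻¹ : ℂ) • x) (by simp [norm_smul, hx'.ne'])
  have e : star ((‖x‖⁻¹ : ℂ) • x) ⬝ᵥ (G z *ᵥ ((‖x‖⁻¹ : ℂ) • x))
      = ((‖x‖⁻¹ ^ 2 : ℝ) : ℂ) * (star x ⬝ᵥ (G z *ᵥ x)) := by
    rw [star_smul, Matrix.mulVec_smul, smul_dotProduct, dotProduct_smul]
    simp only [smul_eq_mul, Complex.star_def, map_inv₀, Complex.conj_ofReal]
    push_cast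
    ring
  rw [e, Complex.re_ofReal_mul] at h2
  exact (pos_of_mul_pos_right h2 (by positivity)).le

end Smear

/-! ### The limit current -/

section Limit

variable {n : ℕ} {X : Type*} [TopologicalSpace X] [ChartedSpace (Cn n) X] [MeasurableSpace X]
  [BorelSpace X] {e : OpenPartialHomeomorph X (Cn n)}
  {om chi : KahlerForm n X} {chis : ℕ → KahlerForm n X} {psis : ℕ → X → ℝ} {psi : X → ℝ}

/-- The currents `χ_k` converge weakly to `χ + √-1 ∂∂̄ ψ`. -/
theorem tendsto_smear_addCurrent (hchis : ∀ k, IsAddDDbar (chis k) chi (psis k))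
    (hpsi : AEStronglyMeasurable psi om.vol)
    (hL1 : Tendsto (fun k => eLpNorm (fun x => psis k x - psi x) 1 om.vol) atTop (𝓝 0))
    (he : IsHolChart n e) {eta : Cn n → ℝ} (h : IsTestOn eta e.target) :
    Tendsto (fun k => smear ((chis k).coeff e) eta) atTop (𝓝 (addCurrent chi psi e eta)) := by
  have hsm : ∀ k, ContDiffOn ℝ ∞ (fun w => psis k (e.symm w)) e.target := fun k =>
    contDiffOn_comp_symm (hchis k).1 he
  have hmeas : ∀ k, AEStronglyMeasurable (psis k) om.vol := fun k =>
    (hchis k).1.continuous.aestronglyMeasurable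
  have hK : IsCompact (tsupport eta) := h.2.1
  have heq : ∀ k j l, smear ((chis k).coeff e) eta j l
      = (∫ z, chi.coeff e z j l * (eta z : ℂ))
        + ∫ z, ((psis k (e.symm z) : ℝ) : ℂ) * complexHessian eta z j l := by
    intro k j l
    have h1 := h.ddbarCurrent_eq e.open_target (hsm k) j l
    rw [ddbarCurrent] at h1
    rw [h1, ← integral_add (h.integrable_entry_mul (chi.continuousOn_coeff he) j l)
      (h.integrable_entry_mul (continuousOn_complexHessian e.open_target (hsm k)) j l)]
    refine integral_congr_ae (Eventually.of_forall fun z => ?_)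
    by_cases hz : z ∈ e.target
    · simp only
      rw [(hchis k).2 e he z hz, Matrix.add_apply, add_mul]
    · simp [image_eq_zero_of_notMem_tsupport fun hz' => hz (h.2.2 hz')]
  refine tendsto_pi_nhds.mpr fun j => tendsto_pi_nhds.mpr fun l => ?_
  simp only [heq]
  refine tendsto_const_nhds.add ?_
  refine tendsto_integral_mul_of_tendsto_eLpNorm_restrict (𝕜 := ℂ) hK hK.measurableSet
    ((continuous_apply_apply j l).comp h.continuous_complexHessian) (fun z hz => ?_)
    (fun k => ((hsm k).continuousOn.mono h.2.2).integrableOn_compact hK)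
    (om.aestronglyMeasurable_comp_symm he hK h.2.2 hpsi) ?_
  · exact image_eq_zero_of_notMem_tsupport (f := fun z => complexHessian eta z j l)
      fun hz' => hz (tsupport_complexHessian_subset eta j l hz')
  · exact om.tendsto_eLpNorm_comp_symm he hK h.2.2 le_rfl ENNReal.one_ne_top
      (f := fun k x => psis k x - psi x) (fun k => (hmeas k).sub hpsi) hL1

/-- The limit current is a weak limit of the positive forms `χ_k`, hence positive. -/
theorem isPositiveCurrent_of_tendsto (hchis : ∀ k, IsAddDDbar (chis k) chi (psis k))
    (hpsi : AEStronglyMeasurable psi om.vol)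
    (hL1 : Tendsto (fun k => eLpNorm (fun x => psis k x - psi x) 1 om.vol) atTop (𝓝 0)) :
    IsPositiveCurrent chi psi := by
  intro e he eta h hpos
  have hlim := tendsto_smear_addCurrent hchis hpsi hL1 he h
  have hps : ∀ k, (smear ((chis k).coeff e) eta).PosSemidef := fun k =>
    h.smear_posSemidef ((chis k).continuousOn_coeff he) hpos
      fun z hz => ((chis k).coeff_posDef he hz).posSemidef
  refine Matrix.PosSemidef.of_dotProduct_mulVec_nonneg ?_ fun x => ?_
  · have h1 := hlim.star
    refine tendsto_nhds_unique h1 (hlim.congr fun k => ?_)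
    exact (hps k).1.symm
  · have hc : Continuous fun A : Matrix (Fin n) (Fin n) ℂ => dotProduct (star x) (A.mulVec x) :=
      continuous_const.dotProduct (continuous_id.matrix_mulVec continuous_const)
    exact ge_of_tendsto' ((hc.tendsto _).comp hlim) fun k => (hps k).dotProduct_mulVec_nonneg x

/-- In the limit, all averages of the current `χ + √-1 ∂∂̄ ψ` near a point `z₀` lie in the
sublevel set `{Q ≤ (1 + δ) c}`: the functions `Q_{ω(z₀)}` are convex, `ω(z₀) ≤ (1 + δ) ω(z)` for
`z` near `z₀`, and the averages of `Q_ω(χ_k)` tend to `c`. -/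
theorem exists_forall_dualQ_addCurrent_le [IsManifold 𝓘(ℂ, Cn n) ∞ X] {c : ℝ}
    (hchis : ∀ k, IsAddDDbar (chis k) chi (psis k)) (hpsi : AEStronglyMeasurable psi om.vol)
    (hL1 : Tendsto (fun k => eLpNorm (fun x => psis k x - psi x) 1 om.vol) atTop (𝓝 0))
    (hL2 : Tendsto (fun k => eLpNorm (fun x => Qform om (chis k) x - c) 2 om.vol) atTop (𝓝 0))
    (he : IsHolChart n e) {z₀ : Cn n} (hz₀ : z₀ ∈ e.target) {δ : ℝ} (hδ : 0 < δ) :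
    ∃ r > 0, ∀ eta : Cn n → ℝ, IsTestOn eta (Metric.ball z₀ r) → (∀ z, 0 ≤ eta z) →
      ∫ z, eta z = 1 → ∀ Z, dualQ (om.coeff e z₀) Z (addCurrent chi psi e eta) ≤ (1 + δ) * c := by
  set B := om.coeff e z₀ with hB
  have hBpos : B.PosDef := om.coeff_posDef he hz₀
  have hnhds : e.target ∈ 𝓝 z₀ := e.open_target.mem_nhds hz₀
  have hev : ∀ᶠ z in 𝓝 z₀, (((1 + δ : ℝ) : ℂ) • om.coeff e z - B).PosSemidef := by
    refine eventually_posSemidef ?_ ?_ ?_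
    · exact ContinuousAt.sub (ContinuousAt.const_smul (M := ℂ)
        ((om.continuousOn_coeff he).continuousAt hnhds) _) continuousAt_const
    · filter_upwards [hnhds] with z hz
      have h1 := (om.coeff_posDef he hz).1
      refine Matrix.IsHermitian.sub ?_ hBpos.1
      rw [Matrix.IsHermitian, Matrix.conjTranspose_smul, h1.eq]
      simp
    · have : ((1 + δ : ℝ) : ℂ) • om.coeff e z₀ - B = (δ : ℂ) • B := by
        rw [← hB]; push_cast; rw [add_smul, one_smul, add_sub_cancel_left]
      rw [this]
      exact hBpos.smul (Complex.zero_lt_real.mpr hδ)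
  obtain ⟨r, hr, hball⟩ := Metric.eventually_nhds_iff_ball.mp (hev.and hnhds)
  refine ⟨r, hr, fun eta h hpos hint Z => ?_⟩
  have h' : IsTestOn eta e.target := ⟨h.1, h.2.1, h.2.2.trans fun z hz => (hball z hz).2⟩
  have hK : IsCompact (tsupport eta) := h.2.1
  have hQc : ∀ k, ContinuousOn (fun z => Q (om.coeff e z) ((chis k).coeff e z)) e.target :=
    fun k => continuousOn_Q_coeff om (chis k) he
  have hle : ∀ k, dualQ B Z (smear ((chis k).coeff e) eta)
      ≤ (1 + δ) * ∫ z, Q (om.coeff e z) ((chis k).coeff e z) * eta z := by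
    intro k
    rw [← integral_const_mul]
    simp only [← mul_assoc]
    refine h'.dualQ_smear_le ((chis k).continuousOn_coeff he) hpos hint
      (continuousOn_const.mul (hQc k)) fun z hz => ?_
    have hzt := h'.2.2 hz
    have hA := (chis k).coeff_posDef he hzt
    exact (dualQ_le_Q hA hBpos Z).trans
      (Q_le_mul_Q hA hBpos (om.coeff_posDef he hzt) (hball z (h.2.2 hz)).1)
  have hlim1 := ((continuous_dualQ B Z).tendsto _).comp
    (tendsto_smear_addCurrent hchis hpsi hL1 he h')
  have hlimQ : Tendsto (fun k => ∫ z, Q (om.coeff e z) ((chis k).coeff e z) * eta z) atTop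
      (𝓝 (∫ z, c * eta z)) := by
    refine tendsto_integral_mul_of_tendsto_eLpNorm_restrict (𝕜 := ℝ) hK hK.measurableSet
      h.1.continuous (fun z hz => image_eq_zero_of_notMem_tsupport hz)
      (fun k => ((hQc k).mono h'.2.2).integrableOn_compact hK) aestronglyMeasurable_const ?_
    refine (om.tendsto_eLpNorm_comp_symm he hK h'.2.2 (p := 2) (by norm_num) (by simp)
      (f := fun k x => Qform om (chis k) x - c)
      (fun k => ((continuous_Qform om (chis k)).sub continuous_const).aestronglyMeasurable)
      hL2).congr fun k => ?_
    refine eLpNorm_congr_ae ?_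
    filter_upwards [ae_restrict_mem hK.measurableSet] with z hz
    rw [Qform_symm_apply om (chis k) he (h'.2.2 hz)]
    rfl
  rw [integral_const_mul, hint, mul_one] at hlimQ
  exact le_of_tendsto_of_tendsto' hlim1 (hlimQ.const_mul _) hle

end Limit

/-! ### Mollification by radial kernels -/

section Mollifier

variable {n : ℕ}

theorem contDiff_expNegInvGlue_norm_sq (ε : ℝ) :
    ContDiff ℝ ∞ fun w : Cn n => expNegInvGlue (ε ^ 2 - ‖w‖ ^ 2) :=
  (expNegInvGlue.contDiff (n := ⊤)).comp (contDiff_const.sub (contDiff_norm_sq ℝ))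

/-- A smooth function on `ℂⁿ` which depends only on the norm, is positive on the ball of radius `ε`
about `0`, vanishes elsewhere, and has integral `1`. -/
noncomputable def radialBump (n : ℕ) (ε : ℝ) (w : Cn n) : ℝ :=
  (∫ y : Cn n, expNegInvGlue (ε ^ 2 - ‖y‖ ^ 2))⁻¹ * expNegInvGlue (ε ^ 2 - ‖w‖ ^ 2)

variable {ε : ℝ}

theorem expNegInvGlue_eq_zero_of_le_norm (hε : 0 < ε) {w : Cn n} (hw : ε ≤ ‖w‖) :
    expNegInvGlue (ε ^ 2 - ‖w‖ ^ 2) = 0 :=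
  expNegInvGlue.zero_of_nonpos (by nlinarith)

theorem radialBump_eq_zero_of_le_norm (hε : 0 < ε) {w : Cn n} (hw : ε ≤ ‖w‖) :
    radialBump n ε w = 0 := by
  rw [radialBump, expNegInvGlue_eq_zero_of_le_norm hε hw, mul_zero]

theorem hasCompactSupport_expNegInvGlue_norm_sq (hε : 0 < ε) :
    HasCompactSupport fun w : Cn n => expNegInvGlue (ε ^ 2 - ‖w‖ ^ 2) :=
  HasCompactSupport.intro (isCompact_closedBall (0 : Cn n) ε) fun w hw =>
    expNegInvGlue_eq_zero_of_le_norm hε (le_of_not_ge fun h => hw (by simpa using h))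

theorem integral_expNegInvGlue_norm_sq_pos (hε : 0 < ε) :
    0 < ∫ y : Cn n, expNegInvGlue (ε ^ 2 - ‖y‖ ^ 2) := by
  refine (contDiff_expNegInvGlue_norm_sq ε).continuous
    |>.integral_pos_of_hasCompactSupport_nonneg_nonzero (x := 0)
    (hasCompactSupport_expNegInvGlue_norm_sq hε) (fun _ => expNegInvGlue.nonneg _) ?_
  exact (expNegInvGlue.pos_of_pos (by simpa using pow_pos hε 2)).ne'

theorem contDiff_radialBump (ε : ℝ) : ContDiff ℝ ∞ (radialBump n ε) :=
  contDiff_const.mul (contDiff_expNegInvGlue_norm_sq ε)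

theorem hasCompactSupport_radialBump (hε : 0 < ε) : HasCompactSupport (radialBump n ε) :=
  (hasCompactSupport_expNegInvGlue_norm_sq hε).mul_left

theorem radialBump_nonneg (hε : 0 < ε) (w : Cn n) : 0 ≤ radialBump n ε w :=
  mul_nonneg (inv_nonneg.mpr (integral_expNegInvGlue_norm_sq_pos hε).le) (expNegInvGlue.nonneg _)

theorem integral_radialBump (hε : 0 < ε) : ∫ w, radialBump n ε w = 1 := by
  unfold radialBump
  rw [integral_const_mul]
  exact inv_mul_cancel₀ (integral_expNegInvGlue_norm_sq_pos hε).ne'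

theorem radialBump_congr_norm {w w' : Cn n} (h : ‖w‖ = ‖w'‖) :
    radialBump n ε w = radialBump n ε w' := by
  rw [radialBump, radialBump, h]

theorem isTestOn_radialBump_sub (hε : 0 < ε) {z : Cn n} {U : Set (Cn n)}
    (hU : Metric.closedBall z ε ⊆ U) : IsTestOn (fun t => radialBump n ε (z - t)) U := by
  have hz : ∀ t, t ∉ Metric.closedBall z ε → radialBump n ε (z - t) = 0 := fun t ht =>
    radialBump_eq_zero_of_le_norm hε (by
      rw [← dist_eq_norm, dist_comm]
      exact le_of_not_ge fun h => ht (by simpa using h))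
  refine ⟨(contDiff_radialBump ε).comp (contDiff_const.sub contDiff_id),
    HasCompactSupport.intro (isCompact_closedBall z ε) hz, (closure_minimal ?_
      Metric.isClosed_closedBall).trans hU⟩
  intro t ht
  by_contra h
  exact ht (hz t h)

/-- The convolution of `f` with the radial bump function of radius `ε`. -/
noncomputable def mollify (f : Cn n → ℝ) (ε : ℝ) (z : Cn n) : ℝ :=
  ∫ t, f t * radialBump n ε (z - t)

theorem contDiff_integral_mul_sub {f g : Cn n → ℝ} (hf : LocallyIntegrable f)
    (hg : ContDiff ℝ ∞ g) (hgc : HasCompactSupport g) :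
    ContDiff ℝ ∞ fun z => ∫ t, f t * g (z - t) :=
  hgc.contDiff_convolution_right (ContinuousLinearMap.mul ℝ ℝ) (n := ⊤) hf hg

theorem fderiv_integral_mul_sub {f g : Cn n → ℝ} (hf : LocallyIntegrable f)
    (hg : ContDiff ℝ ∞ g) (hgc : HasCompactSupport g) (z v : Cn n) :
    fderiv ℝ (fun z => ∫ t, f t * g (z - t)) z v = ∫ t, f t * fderiv ℝ g (z - t) v := by
  have h := hgc.hasFDerivAt_convolution_right (ContinuousLinearMap.mul ℝ ℝ) hf
    (hg.of_le (by simp)) z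
  have h' : fderiv ℝ (fun z => ∫ t, f t * g (z - t)) z = _ := h.fderiv
  rw [h', convolution_precompR_apply _ hf (hgc.fderiv ℝ) (hg.continuous_fderiv (by simp))]
  rfl

theorem isTestOn_univ {g : Cn n → ℝ} (hg : ContDiff ℝ ∞ g) (hgc : HasCompactSupport g) :
    IsTestOn g Set.univ := ⟨hg, hgc, Set.subset_univ _⟩

theorem fderiv_fderiv_integral_mul_sub {f g : Cn n → ℝ} (hf : LocallyIntegrable f)
    (hg : ContDiff ℝ ∞ g) (hgc : HasCompactSupport g) (z v w : Cn n) :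
    fderiv ℝ (fderiv ℝ fun z => ∫ t, f t * g (z - t)) z v w
      = ∫ t, f t * fderiv ℝ (fderiv ℝ g) (z - t) v w := by
  have hgt := isTestOn_univ hg hgc
  rw [← fderiv_fderiv_apply ((contDiff_integral_mul_sub hf hg hgc).contDiffAt.of_le two_le_infty)]
  simp only [fderiv_integral_mul_sub hf hg hgc]
  rw [fderiv_integral_mul_sub hf (hgt.fderiv_apply w).1 (hgt.fderiv_apply w).2.1]
  simp only [fderiv_fderiv_apply (hgt.contDiffAt _)]

theorem fderiv_const_sub_apply {g : Cn n → ℝ} (hg : Differentiable ℝ g) (z t v : Cn n) :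
    fderiv ℝ (fun t => g (z - t)) t v = -fderiv ℝ g (z - t) v := by
  have h := (hg (z - t)).hasFDerivAt.comp t ((hasFDerivAt_id t).const_sub z)
  have h' : fderiv ℝ (fun t => g (z - t)) t = _ := h.fderiv
  rw [h']
  simp

theorem fderiv_fderiv_const_sub_apply {g : Cn n → ℝ} (hg : ContDiff ℝ ∞ g) (z t v w : Cn n) :
    fderiv ℝ (fderiv ℝ fun t => g (z - t)) t v w = fderiv ℝ (fderiv ℝ g) (z - t) v w := by
  have hc : ContDiff ℝ ∞ fun t => g (z - t) := hg.comp (contDiff_const.sub contDiff_id)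
  have hw : ContDiff ℝ ∞ fun t => fderiv ℝ g t w :=
    (hg.fderiv_right (m := ∞) (by simp)).clm_apply contDiff_const
  rw [← fderiv_fderiv_apply (hc.contDiffAt.of_le two_le_infty)]
  simp only [fderiv_const_sub_apply (hg.differentiable (by simp))]
  rw [fderiv_fun_neg, neg_apply, fderiv_const_sub_apply (hw.differentiable (by simp)), neg_neg,
    fderiv_fderiv_apply (hg.contDiffAt.of_le two_le_infty)]

/-- The complex Hessian of a mollified function is the current `√-1 ∂∂̄ f` evaluated on the
translates of the mollifier. -/
theorem complexHessian_mollify {f : Cn n → ℝ} (hf : Integrable f) (hε : 0 < ε) (z : Cn n) :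
    complexHessian (mollify f ε) z = ddbarCurrent f fun t => radialBump n ε (z - t) := by
  have hg := contDiff_radialBump (n := n) ε
  have hgc := hasCompactSupport_radialBump (n := n) hε
  have ht := isTestOn_radialBump_sub hε (z := z) (Set.subset_univ _)
  have hi : ∀ v w, Integrable fun t =>
      f t * fderiv ℝ (fderiv ℝ fun t => radialBump n ε (z - t)) t v w := by
    intro v w
    have h := ht.fderiv_fderiv_apply v w
    obtain ⟨C, hC⟩ := h.2.1.exists_bound_of_continuous h.1.continuous
    exact hf.mul_bdd h.1.continuous.aestronglyMeasurable (Eventually.of_forall hC)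
  ext j k
  rw [ddbarCurrent_apply hi]
  simp only [fderiv_fderiv_const_sub_apply hg]
  simp only [← fderiv_fderiv_integral_mul_sub hf.locallyIntegrable hg hgc]
  rfl

theorem integrable_mul_radialBump {f : Cn n → ℝ} (hf : Integrable f) (hε : 0 < ε) (z : Cn n) :
    Integrable fun t => f t * radialBump n ε (z - t) := by
  have h := isTestOn_radialBump_sub hε (z := z) (Set.subset_univ _)
  obtain ⟨C, hC⟩ := h.2.1.exists_bound_of_continuous h.1.continuous
  exact hf.mul_bdd h.1.continuous.aestronglyMeasurable (Eventually.of_forall hC)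

theorem mollify_le_of_ae_le {f : Cn n → ℝ} (hf : Integrable f) (hε : 0 < ε) {z : Cn n} {C : ℝ}
    (h : ∀ᵐ t, t ∈ Metric.ball z ε → f t ≤ C) : mollify f ε z ≤ C := by
  have ht := isTestOn_radialBump_sub hε (z := z) (Set.subset_univ _)
  calc mollify f ε z ≤ ∫ t, C * radialBump n ε (z - t) := by
        refine integral_mono_ae (integrable_mul_radialBump hf hε z)
          ((ht.1.continuous.integrable_of_hasCompactSupport ht.2.1).const_mul C) ?_
        filter_upwards [h] with t ht
        by_cases hb : t ∈ Metric.ball z ε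
        · exact mul_le_mul_of_nonneg_right (ht hb) (radialBump_nonneg hε _)
        · have : radialBump n ε (z - t) = 0 := radialBump_eq_zero_of_le_norm hε (by
            rw [← dist_eq_norm, dist_comm]
            exact le_of_not_gt fun h => hb (by simpa using h))
          simp [this]
    _ = C := by
        rw [integral_const_mul, integral_sub_left_eq_self (radialBump n ε), integral_radialBump hε,
          mul_one]

end Mollifier

/-! ### The sub-mean value property -/

section SubMean

variable {n : ℕ}

/-- Multiplication by a complex number of modulus one, as a real isometry of `ℂⁿ`. -/
noncomputable def rotation (n : ℕ) (θ : ℝ) : Cn n ≃ₗᵢ[ℝ] Cn n where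
  toLinearEquiv := (LinearEquiv.smulOfNeZero ℂ (Cn n) (Complex.exp (θ * Complex.I))
    (Complex.exp_ne_zero _)).restrictScalars ℝ
  norm_map' w := by
    change ‖Complex.exp (θ * Complex.I) • w‖ = ‖w‖
    rw [norm_smul, Complex.norm_exp_ofReal_mul_I, one_mul]

/-- Averaging over rotations: the integral of an integrable function is its mean over circles,
integrated. -/
theorem integral_eq_integral_circle {G : Cn n → ℝ} (hG : Integrable G) :
    Integrable (fun w => ∫ θ in Set.Ioc 0 (2 * Real.pi), G (rotation n θ w)) ∧
    ∫ w, (∫ θ in Set.Ioc 0 (2 * Real.pi), G (rotation n θ w)) = 2 * Real.pi * ∫ w, G w := by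
  set μ := (volume : Measure ℝ).restrict (Set.Ioc 0 (2 * Real.pi)) with hμ
  have hmp : MeasurePreserving (fun p : ℝ × Cn n => (p.1, rotation n p.1 p.2))
      (μ.prod volume) (μ.prod volume) := by
    refine MeasurePreserving.skew_product (MeasurePreserving.id μ)
      (g := fun θ w => rotation n θ w) (μc := volume) (μd := volume) ?_ ?_
    · refine Continuous.measurable ?_
      change Continuous fun p : ℝ × Cn n => Complex.exp (p.1 * Complex.I) • p.2
      fun_prop
    · exact Eventually.of_forall fun θ => (rotation n θ).measurePreserving.map_eq
  have hint : Integrable (fun p : ℝ × Cn n => G (rotation n p.1 p.2)) (μ.prod volume) := by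
    have h := hG.comp_snd μ
    exact (hmp.integrable_comp h.aestronglyMeasurable).mpr h
  refine ⟨hint.integral_prod_right, ?_⟩
  rw [← integral_integral_swap (f := fun θ w => G (rotation n θ w)) hint]
  have : ∀ θ, ∫ w, G (rotation n θ w) = ∫ w, G w := fun θ =>
    (rotation n θ).measurePreserving.integral_comp
      (rotation n θ).toHomeomorph.measurableEmbedding G
  simp only [this]
  rw [integral_const, smul_eq_mul]
  congr 1
  simp [hμ, Real.pi_pos.le]

/-- Convolution with a radial kernel does not decrease a plurisubharmonic function. -/
theorem IsPSHOn.le_mollify {phi : Cn n → EReal} {V : Set (Cn n)} (h : IsPSHOn phi V) {z₀ : Cn n}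
    {ε R : ℝ} (hε : 0 < ε) (hεR : ε ≤ R) (hR : Metric.closedBall z₀ R ⊆ V)
    (hbot : phi z₀ ≠ ⊥) {f : Cn n → ℝ} (hf : Integrable f)
    (hfphi : ∀ z ∈ Metric.closedBall z₀ R, f z = (phi z).toReal) :
    (phi z₀).toReal ≤ mollify f ε z₀ := by
  have hR0 : 0 ≤ R := hε.le.trans hεR
  set G : Cn n → ℝ := fun w => f (z₀ + w) * radialBump n ε w with hGdef
  have hρ : ∀ w : Cn n, radialBump n ε (z₀ - (z₀ + w)) = radialBump n ε w := fun w =>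
    radialBump_congr_norm (by simp)
  have hG : Integrable G := by
    have h1 := (integrable_mul_radialBump hf hε z₀).comp_add_left z₀
    simpa only [hρ] using h1
  have hmol : mollify f ε z₀ = ∫ w, G w := by
    rw [mollify, ← integral_add_left_eq_self _ z₀]
    simp only [hρ]
    rfl
  obtain ⟨hi, he⟩ := integral_eq_integral_circle hG
  have hle : ∀ w, 2 * Real.pi * (phi z₀).toReal * radialBump n ε w
      ≤ ∫ θ in Set.Ioc 0 (2 * Real.pi), G (rotation n θ w) := by
    intro w
    have hrot : ∀ θ, G (rotation n θ w) = f (z₀ + rotation n θ w) * radialBump n ε w := fun θ => by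
      simp only [hGdef]
      rw [radialBump_congr_norm ((rotation n θ).norm_map w)]
    simp only [hrot]
    rw [integral_mul_const]
    rcases le_or_gt ε ‖w‖ with hw | hw
    · simp [radialBump_eq_zero_of_le_norm hε hw]
    refine mul_le_mul_of_nonneg_right ?_ (radialBump_nonneg hε w)
    have hmem : ∀ t : ℂ, ‖t‖ ≤ 1 → z₀ + t • w ∈ Metric.closedBall z₀ R := by
      intro t ht
      rw [mem_closedBall_iff_norm, add_sub_cancel_left, norm_smul]
      calc ‖t‖ * ‖w‖ ≤ 1 * R := mul_le_mul ht (hw.le.trans hεR) (norm_nonneg _) zero_le_one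
        _ = R := one_mul R
    obtain ⟨-, -, hsub⟩ := h.submean z₀ (hR (Metric.mem_closedBall_self hR0)) w
      (fun t ht => hR (hmem t ht)) hbot
    rw [intervalIntegral.integral_of_le (by positivity)] at hsub
    have e : ∫ θ in Set.Ioc 0 (2 * Real.pi), f (z₀ + rotation n θ w)
        = ∫ θ in Set.Ioc (0 : ℝ) (2 * Real.pi),
          (phi (z₀ + Complex.exp (θ * Complex.I) • w)).toReal := by
      refine integral_congr_ae (Eventually.of_forall fun θ => ?_)
      exact hfphi _ (hmem _ (Complex.norm_exp_ofReal_mul_I θ).le)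
    rw [e]
    rwa [inv_mul_eq_div, le_div_iff₀ (by positivity), mul_comm] at hsub
  have hρi : Integrable (radialBump n ε) :=
    (contDiff_radialBump ε).continuous.integrable_of_hasCompactSupport
      (hasCompactSupport_radialBump hε)
  have h1 := integral_mono (hρi.const_mul _) hi hle
  rw [he, integral_const_mul, integral_radialBump hε, mul_one] at h1
  rw [hmol]
  exact le_of_mul_le_mul_left h1 (by positivity)

end SubMean

/-! ### Comparison with upper tests -/

section Comparison

variable {n : ℕ}

theorem ddbarCurrent_congr {f g eta : Cn n → ℝ} (h : ∀ z ∈ tsupport eta, f z = g z) :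
    ddbarCurrent f eta = ddbarCurrent g eta := by
  ext j k
  refine integral_congr_ae (Eventually.of_forall fun z => ?_)
  by_cases hz : z ∈ tsupport eta
  · simp only [h z hz]
  · have : complexHessian eta z j k = 0 :=
      image_eq_zero_of_notMem_tsupport (f := fun z => complexHessian eta z j k)
        fun hz' => hz (tsupport_complexHessian_subset eta j k hz')
    simp [this]

/-- The comparison step near `z₀`. If `q` touches `φ` from above at `z₀`, then, arbitrarily near
`z₀`, some mollification `u` of `φ` minus `q + a ‖z - z₀‖²` has an interior local maximum: it is
nonnegative at `z₀` by the sub-mean value property, and negative on a small sphere since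
mollifications of `φ` are at most slightly larger than `q`. -/
theorem IsPSHOn.exists_isLocalMax_mollify {phi : Cn n → EReal} {V : Set (Cn n)}
    (h : IsPSHOn phi V) (hV : IsOpen V) {z₀ : Cn n} (hz₀ : z₀ ∈ V) {q : Cn n → ℝ}
    (hq : IsUpperTest q phi z₀) {a : ℝ} (ha : 0 < a) {W : Set (Cn n)} (hW : W ∈ 𝓝 z₀) :
    ∃ ε > 0, ∃ z₁, ∃ f : Cn n → ℝ, Integrable f ∧ Metric.closedBall z₁ ε ⊆ W ∩ V ∧
      (∀ z ∈ Metric.closedBall z₁ ε, f z = (phi z).toReal) ∧ ContDiffAt ℝ 2 q z₁ ∧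
      IsLocalMax (fun z => mollify f ε z + ((-1) * q z + (-a) * ‖z - z₀‖ ^ 2)) z₁ := by
  obtain ⟨hq2, hqge, hqz⟩ := hq
  have hV' : ∀ᶠ z in 𝓝 z₀, z ∈ V := hV.mem_nhds hz₀
  have hW' : ∀ᶠ z in 𝓝 z₀, z ∈ W := hW
  obtain ⟨R, hR, hball⟩ := Metric.nhds_basis_closedBall.eventually_iff.mp
    ((hq2.eventually (by simp)).and (hqge.and (hV'.and hW')))
  set S := Metric.closedBall z₀ R with hS
  have hScomp : IsCompact S := isCompact_closedBall _ _
  have hSV : S ⊆ V := fun z hz => (hball hz).2.2.1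
  set f : Cn n → ℝ := S.indicator fun z => (phi z).toReal with hf
  have hfS : ∀ z ∈ S, f z = (phi z).toReal := fun z hz => Set.indicator_of_mem hz _
  have hfi : Integrable f :=
    (integrable_indicator_iff hScomp.measurableSet).mpr
      (h.locInt.integrableOn_compact_subset hSV hScomp)
  have hfq : ∀ᵐ z, z ∈ S → f z ≤ q z := by
    have hae := (ae_restrict_iff' hV.measurableSet).mp h.ae_ne_bot
    filter_upwards [hae] with z hz hzS
    rw [hfS z hzS]
    have h1 : phi z ≤ (q z : EReal) := (hball hzS).2.1
    rw [← EReal.coe_toReal (h.ne_top z (hSV hzS)) (hz (hSV hzS))] at h1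
    exact_mod_cast h1
  -- The maximum is sought on the ball of radius `s`, so that the mollifications on that ball, in
  -- radius `ε < s`, only involve values of `f` on the ball `S` of radius `2 s = R`.
  set s := R / 2 with hs
  have hs0 : 0 < s := half_pos hR
  have hqc : ContinuousOn q S := fun z hz => (hball hz).1.continuousAt.continuousWithinAt
  have huc := hScomp.uniformContinuousOn_of_continuous hqc
  obtain ⟨ε₀, hε₀, hε₀'⟩ := Metric.uniformContinuousOn_iff.mp huc (a * s ^ 2 / 2) (by positivity)
  set ε := min ε₀ (s / 2) with hε
  have hεpos : 0 < ε := lt_min hε₀ (half_pos hs0)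
  have hεs : ε < s := (min_le_right _ _).trans_lt (half_lt_self hs0)
  have hsub : ∀ z ∈ Metric.closedBall z₀ s, Metric.closedBall z ε ⊆ S := by
    intro z hz
    refine Metric.closedBall_subset_closedBall' ?_
    have := Metric.mem_closedBall.mp hz
    linarith
  have hmolC : ContDiff ℝ ∞ (mollify f ε) :=
    contDiff_integral_mul_sub hfi.locallyIntegrable (contDiff_radialBump ε)
      (hasCompactSupport_radialBump hεpos)
  set F : Cn n → ℝ := fun z => mollify f ε z + ((-1) * q z + (-a) * ‖z - z₀‖ ^ 2) with hF
  have hss : Metric.closedBall z₀ s ⊆ S := Metric.closedBall_subset_closedBall (by linarith)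
  have hFc : ContinuousOn F (Metric.closedBall z₀ s) := by
    refine hmolC.continuous.continuousOn.add ((continuousOn_const.mul (hqc.mono hss)).add ?_)
    exact Continuous.continuousOn (by fun_prop)
  obtain ⟨z₁, hz₁, hmax⟩ := (isCompact_closedBall z₀ s).exists_isMaxOn
    ⟨z₀, Metric.mem_closedBall_self hs0.le⟩ hFc
  have hF0 : 0 ≤ F z₀ := by
    have hbot : phi z₀ ≠ ⊥ := by rw [hqz]; exact EReal.coe_ne_bot _
    have h1 := h.le_mollify hεpos (by linarith : ε ≤ R) hSV hbot hfi hfS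
    rw [hqz, EReal.toReal_coe] at h1
    simp only [hF, sub_self, norm_zero]
    linarith
  have hmol : ∀ z ∈ Metric.closedBall z₀ s, mollify f ε z ≤ q z + a * s ^ 2 / 2 := by
    intro z hz
    refine mollify_le_of_ae_le hfi hεpos ?_
    filter_upwards [hfq] with t ht htb
    have htS : t ∈ S := hsub z hz (Metric.ball_subset_closedBall htb)
    have h2 := hε₀' t htS z (hss hz) ((Metric.mem_ball.mp htb).trans_le (min_le_left _ _))
    rw [Real.dist_eq] at h2
    linarith [ht htS, (abs_lt.mp h2).2]
  have hz₁lt : dist z₁ z₀ < s := by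
    refine lt_of_le_of_ne (Metric.mem_closedBall.mp hz₁) fun heq => ?_
    have h1 : F z₀ ≤ F z₁ := hmax (Metric.mem_closedBall_self hs0.le)
    have h2 := hmol z₁ hz₁
    have h3 : F z₁ < 0 := by
      simp only [hF]
      rw [← dist_eq_norm, heq]
      have : 0 < a * s ^ 2 := by positivity
      linarith
    linarith
  refine ⟨ε, hεpos, z₁, f, hfi, fun z hz => ?_, fun z hz => hfS z (hsub z₁ hz₁ hz),
    (hball (hss hz₁)).1, ?_⟩
  · have := hball (hsub z₁ hz₁ hz)
    exact ⟨this.2.2.2, this.2.2.1⟩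
  · exact hmax.isLocalMax (Metric.closedBall_mem_nhds_of_mem hz₁lt)

/-- If the averages of the current `√-1 ∂∂̄ φ` near `z₀` satisfy the inequalities which define the
sublevel set `{Q_B ≤ M}`, then so does the complex Hessian at `z₀` of every upper test. -/
theorem IsPSHOn.dualQ_complexHessian_le {phi : Cn n → EReal} {V : Set (Cn n)}
    (h : IsPSHOn phi V) (hV : IsOpen V) {z₀ : Cn n} (hz₀ : z₀ ∈ V) {q : Cn n → ℝ}
    (hq : IsUpperTest q phi z₀) {B : Matrix (Fin n) (Fin n) ℂ} (hB : B.PosSemidef) {M r : ℝ}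
    (hr : 0 < r)
    (hM : ∀ eta : Cn n → ℝ, IsTestOn eta (Metric.ball z₀ r) → IsTestOn eta V →
      (∀ z, 0 ≤ eta z) → ∫ z, eta z = 1 →
      ∀ Z, dualQ B Z (ddbarCurrent (fun z => (phi z).toReal) eta) ≤ M)
    (Z : Matrix (Fin n) (Fin n) ℂ) : dualQ B Z (complexHessian q z₀) ≤ M := by
  set N : Cn n → ℝ := fun z => ‖z - z₀‖ ^ 2 with hN
  have hNc : ContDiff ℝ 2 N := (contDiff_id.sub contDiff_const).norm_sq ℝ
  have hcont := continuous_dualQ B Z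
  have key : ∀ a : ℝ, 0 < a →
      dualQ B Z (complexHessian q z₀ + (a : ℂ) • complexHessian N z₀) ≤ M := by
    intro a ha
    by_contra! hlt
    have hca : ContinuousAt (fun z => dualQ B Z (complexHessian q z + (a : ℂ) • complexHessian N z))
        z₀ :=
      hcont.continuousAt.comp (ContinuousAt.add (continuousAt_complexHessian hq.1)
        (ContinuousAt.const_smul (M := ℂ) (continuousAt_complexHessian hNc.contDiffAt) _))
    have hev := hca.eventually (lt_mem_nhds hlt)
    obtain ⟨ε, hε, z₁, f, hfi, hball, hf, hqz₁, hmax⟩ := h.exists_isLocalMax_mollify hV hz₀ hq ha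
      (inter_mem hev (Metric.ball_mem_nhds z₀ hr))
    have hz₁ := (hball (Metric.mem_closedBall_self hε.le)).1.1
    have hmolC : ContDiffAt ℝ 2 (mollify f ε) z₁ :=
      (contDiff_integral_mul_sub hfi.locallyIntegrable (contDiff_radialBump ε)
        (hasCompactSupport_radialBump hε)).contDiffAt.of_le two_le_infty
    have hq' : ContDiffAt ℝ 2 (fun z => (-1) * q z) z₁ := contDiffAt_const.mul hqz₁
    have hN' : ContDiffAt ℝ 2 (fun z => (-a) * N z) z₁ := contDiffAt_const.mul hNc.contDiffAt
    have hps := complexHessian_neg_posSemidef_of_isLocalMax (hmolC.add (hq'.add hN')) hmax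
    have e : -complexHessian (fun z => mollify f ε z + ((-1) * q z + (-a) * N z)) z₁
        = (complexHessian q z₁ + (a : ℂ) • complexHessian N z₁)
          - complexHessian (mollify f ε) z₁ := by
      rw [complexHessian_add hmolC (hq'.add hN'), complexHessian_add hq' hN',
        complexHessian_const_mul _ hqz₁, complexHessian_const_mul _ hNc.contDiffAt]
      push_cast
      rw [neg_smul, neg_smul, one_smul]
      abel
    have h1 := dualQ_anti (e ▸ hps) hB Z
    have ht := isTestOn_radialBump_sub hε (fun z hz => (hball hz).1.2)
    have h2 := hM _ ht (isTestOn_radialBump_sub hε fun z hz => (hball hz).2)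
      (fun z => radialBump_nonneg hε _)
      (by rw [integral_sub_left_eq_self (radialBump n ε), integral_radialBump hε]) Z
    rw [complexHessian_mollify hfi hε] at h1
    have hts : tsupport (fun t => radialBump n ε (z₁ - t)) ⊆ Metric.closedBall z₁ ε :=
      (isTestOn_radialBump_sub hε subset_rfl).2.2
    rw [ddbarCurrent_congr fun z hz => hf z (hts hz)] at h1
    exact absurd hz₁ (not_lt.mpr (h1.trans h2))
  have hlim : Tendsto (fun a : ℝ => dualQ B Z (complexHessian q z₀
      + (a : ℂ) • complexHessian N z₀)) (𝓝[>] 0) (𝓝 (dualQ B Z (complexHessian q z₀))) := by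
    have hc : Continuous fun a : ℝ => dualQ B Z (complexHessian q z₀
        + (a : ℂ) • complexHessian N z₀) :=
      hcont.comp (continuous_const.add (Continuous.smul (M := ℂ) Complex.continuous_ofReal
        continuous_const))
    have := hc.tendsto 0
    simp only [Complex.ofReal_zero, zero_smul, add_zero] at this
    exact this.mono_left nhdsWithin_le_nhds
  exact le_of_tendsto hlim (eventually_nhdsWithin_of_forall fun a ha => key a ha)

end Comparison

end KahlerVisc

theorem mainTheorem5 {n : ℕ} {X : Type*} [TopologicalSpace X] [T2Space X]
    [SecondCountableTopology X] [ChartedSpace (Cn n) X] [IsManifold 𝓘(ℂ, Cn n) ∞ X]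
    [MeasurableSpace X] [BorelSpace X]
    (om chi : KahlerVisc.KahlerForm n X) (c : ℝ)
    (chis : ℕ → KahlerVisc.KahlerForm n X) (psis : ℕ → X → ℝ) (psi : X → ℝ)
    (hchis : ∀ k, KahlerVisc.IsAddDDbar (chis k) chi (psis k))
    (hpsi : AEStronglyMeasurable psi om.vol)
    (hL1 : Tendsto (fun k => eLpNorm (fun x => psis k x - psi x) 1 om.vol) atTop (𝓝 0))
    (hL2 : Tendsto (fun k => eLpNorm (fun x => KahlerVisc.Qform om (chis k) x - c) 2 om.vol)
      atTop (𝓝 0)) :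
    KahlerVisc.IsViscositySubsolution om chi psi c := by
  refine ⟨KahlerVisc.isPositiveCurrent_of_tendsto hchis hpsi hL1, ?_⟩
  rintro x e he hx V phi hxV ⟨hV, hVe, hpsh, hpot⟩ q hq
  have hB := om.coeff_posDef he (hVe hxV)
  refine KahlerVisc.posDef_and_Q_le_of_dualQ_le (KahlerVisc.complexHessian_isHermitian hq.1) hB
    fun Z => ?_
  have key : ∀ δ : ℝ, 0 < δ →
      KahlerVisc.dualQ (om.coeff e (e x)) Z (KahlerVisc.complexHessian q (e x)) ≤ (1 + δ) * c := by
    intro δ hδ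
    obtain ⟨r, hr, H⟩ := KahlerVisc.exists_forall_dualQ_addCurrent_le hchis hpsi hL1 hL2 he
      (hVe hxV) hδ
    refine hpsh.dualQ_complexHessian_le hV hxV hq hB.posSemidef hr
      (fun eta h1 h2 hpos hint Z => ?_) Z
    rw [hpot eta h2]
    exact H eta h1 hpos hint Z
  have hlim : Tendsto (fun δ : ℝ => (1 + δ) * c) (𝓝[>] 0) (𝓝 c) := by
    have hc : Continuous fun δ : ℝ => (1 + δ) * c := by fun_prop
    have := hc.tendsto 0
    simp only [add_zero, one_mul] at this
    exact this.mono_left nhdsWithin_le_nhds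
  exact ge_of_tendsto hlim (eventually_nhdsWithin_of_forall fun δ hδ => key δ hδ)
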